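/- **Conventions.** For a right Hilbert module $E$ over a $C^*$-algebra $A$ let $\theta_{\xi,\eta}(\zeta)=\xi\langle\eta,\zeta\rangle$ and let $\mathcal K(E)$ be the closed linear span of the operators $\theta_{\xi,\eta}$. A $C^*$-correspondence over $A$ is such an $E$ with a $*$-homomorphism $\phi_E$ from $A$ to the adjointable operators on $E$. Put $J_E=\{a\in A:\phi_E(a)\in\mathcal K(E),\ ab=0\text{ for all }b\in\ker\phi_E\}$. A covariant representation of $E$ on a $C^*$-algebra $D$ is a linear map $\rho_E:E\to D$ together with a $*$-homomorphism $\rho_A:A\to D$ such that $\rho_E(\xi)^*\rho_E(\eta)=\rho_A(\langle\xi,\eta\rangle)$, $\rho_E(\phi_E(a)\xi)=\rho_A(a)\rho_E(\xi)$, and $\rho_E^+(\phi_E(a))=\rho_A(a)$ for $a\in J_E$, where $\rho_E^+:\mathcal K(E)\to D$ is the $*$-homomorphism with $\rho_E^+(\theta_{\xi,\eta})=\rho_E(\xi)\rho_E(\eta)^*$. The Katsura algebra $\mathcal O_E$ is the $C^*$-algebra generated by the image of the universal covariant representation $(\pi_E,\pi_A)$. Let $n\ge 1$. **The correspondence $(X,A)$.**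 $A=\mathbb C^{n+1}$ with minimal projections $P_1,\dots,P_{n+1}$, and $X$ is the vector space with basis $w_{i,j}$ ($1\le i\le n$, $i\le j\le n+1$), where $\langle w_{i,j},w_{k,l}\rangle=\delta_{i,k}\delta_{j,l}P_j$, $w_{i,j}P_k=\delta_{j,k}w_{i,j}$ and $\phi_X(P_k)w_{i,j}=\delta_{i,k}w_{i,j}$. **The correspondence $(Y,B)$.** $B$ is the commutative $C^*$-algebra generated by non-zero mutually orthogonal projections $R_1,\dots,R_{n+1}$ and non-zero mutually orthogonal projections $Q_j\le R_n$ ($j\ge 1$). $Y$ is the Hilbert $B$-module generated by elements $x_{i,j}$ ($1\le i\le n-1$, $i\le j\le n+1$) and $y$ that are mutually orthogonal, with $\langle x_{i,j},x_{i,j}\rangle=R_j$ and $\langle y,y\rangle=R_n$. Write $x_{i,n,j}=x_{i,n}Q_j$, $y'=yQ_1$ and $y_j=yQ_{j+1}$ for $j\ge 1$. The left action is given by $\phi_Y(R_k)x_{i,j}=\delta_{i,k}x_{i,j}$, $\phi_Y(Q_k)x_{i,j}=0$, $\phi_Y(R_k)y=\delta_{n,k}(y-y')+\delta_{n+1,k}y'$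 and $\phi_Y(Q_k)y=y_k$. **Theorem.** The $C^*$-algebras $\mathcal O_X$ and $\mathcal O_Y$ are isomorphic. More precisely, put $s=\pi_X(w_{n,n})+\pi_X(w_{n,n+1})$ and $a_j=s^j\,\pi_A(P_{n+1})\,(s^*)^j$ for $j\ge 1$. There is a $*$-isomorphism $\Pi:\mathcal O_X\to\mathcal O_Y$ with $$\Pi(\pi_A(P_i))=\pi_B(R_i)\ (1\le i\le n+1),\qquad \Pi(\pi_X(w_{i,j}))=\pi_Y(x_{i,j})\ (1\le i\le n-1,\ i\le j\le n+1),$$ $$\Pi(\pi_X(w_{n,n}))=\pi_Y(y)^*-\pi_Y(y')^*,\qquad \Pi(\pi_X(w_{n,n+1}))=\pi_Y(y')^*,$$ whose inverse satisfies $$\Pi^{-1}(\pi_B(R_i))=\pi_A(P_i),\quad \Pi^{-1}(\pi_B(Q_j))=a_j,\quad \Pi^{-1}(\pi_Y(x_{i,j}))=\pi_X(w_{i,j}),\quad \Pi^{-1}(\pi_Y(x_{i,n,j}))=\pi_X(w_{i,n})a_j,$$ $$\Pi^{-1}(\pi_Y(y))=s^*,\qquad \Pi^{-1}(\pi_Y(y'))=\pi_X(w_{n,n+1})^*,\qquad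 \Pi^{-1}(\pi_Y(y_j))=a_js^*$$ for all indices for which the generators are defined. -/

import Mathlib

open scoped ComplexOrder

set_option linter.unusedSectionVars false
set_option linter.unusedVariables false

noncomputable section

namespace CStarCorr

universe u v w

section General

/-! ### Correspondences over a commutative `C⋆`-algebra

Throughout `A` is a commutative `C⋆`-algebra and `E` a (complete) Hilbert `A`-module in the sense
of `CStarModule`.  Since `A` is commutative, `a • ξ` is also the right action `ξ a`. -/

variable {A : Type u} {E : Type v} [NonUnitalCommCStarAlgebra A] [PartialOrder A]
  [StarOrderedRing A] [NormedAddCommGroup E] [NormedSpace ℂ E] [CompleteSpace E] [SMul A E]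
  [CStarModule A E]

variable (A) in
theorem ext_inner {ξ η : E} (h : ∀ ζ : E, inner A ζ ξ = inner A ζ η) : ξ = η := by
  rw [← sub_eq_zero, ← CStarModule.inner_self (A := A), CStarModule.inner_sub_right, h, sub_self]

theorem norm_op_smul_le (a : A) (ξ : E) : ‖a • ξ‖ ≤ ‖a‖ * ‖ξ‖ := by
  have h : ‖a • ξ‖ ^ 2 ≤ (‖a‖ * ‖ξ‖) ^ 2 := by
    rw [CStarModule.norm_sq_eq A, CStarModule.inner_op_smul_right, CStarModule.inner_op_smul_left]
    calc ‖a * (inner A ξ ξ * star a)‖ ≤ ‖a‖ * (‖inner A ξ ξ‖ * ‖star a‖) :=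
          (norm_mul_le _ _).trans (by gcongr; exact norm_mul_le _ _)
      _ = (‖a‖ * ‖ξ‖) ^ 2 := by rw [← CStarModule.norm_sq_eq A, norm_star]; ring
  exact (pow_le_pow_iff_left₀ (norm_nonneg _) (by positivity) two_ne_zero).1 h

variable (A) in
/-- The operator `θ_{ξ,η} : ζ ↦ ξ ⟨η, ζ⟩`. -/
def theta (ξ η : E) : E →L[ℂ] E :=
  LinearMap.mkContinuous
    { toFun := fun ζ => inner A η ζ • ξ
      map_add' := fun x y => ext_inner A fun z => by simp [add_mul]
      map_smul' := fun c x => ext_inner A fun z => by simp [smul_mul_assoc] }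
    (‖η‖ * ‖ξ‖) fun ζ => by
      refine (norm_op_smul_le _ _).trans ?_
      calc ‖inner A η ζ‖ * ‖ξ‖ ≤ (‖η‖ * ‖ζ‖) * ‖ξ‖ := by
            gcongr; exact CStarModule.norm_inner_le E
        _ = ‖η‖ * ‖ξ‖ * ‖ζ‖ := by ring

@[simp]
theorem theta_apply (ξ η ζ : E) : theta A ξ η ζ = inner A η ζ • ξ := rfl

variable (A E) in
/-- The compact operators `𝒦(E)`: the closed linear span of the operators `θ_{ξ,η}`. -/
def compacts : Submodule ℂ (E →L[ℂ] E) :=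
  (Submodule.span ℂ (Set.range fun p : E × E => theta A p.1 p.2)).topologicalClosure

instance : IsBoundedSMul ℂ (compacts A E) :=
  @NormedSpace.toIsBoundedSMul ℂ (compacts A E) _ _ (compacts A E).normedSpace

theorem theta_mem (ξ η : E) : theta A ξ η ∈ compacts A E :=
  Submodule.le_topologicalClosure _ (Submodule.subset_span ⟨(ξ, η), rfl⟩)

variable (A E) in
/-- The left action of a `C⋆`-correspondence: a `⋆`-homomorphism from `A` to the adjointable
operators on `E`, the adjoint of `φ a` being `φ (star a)`. -/
structure LeftAction where
  toHom : A →ₙₐ[ℂ] (E →L[ℂ] E)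
  adjoint : ∀ (a : A) (ξ η : E), inner A (toHom a ξ) η = inner A ξ (toHom (star a) η)

/-- Katsura's ideal `J_E`. -/
def katsuraIdeal (φ : LeftAction A E) : Set A :=
  {a | φ.toHom a ∈ compacts A E ∧ ∀ b, φ.toHom b = 0 → a * b = 0}

/-- A (not necessarily covariant) representation of the correspondence `E` on a `C⋆`-algebra. -/
structure Representation (φ : LeftAction A E) (D : Type w) [NonUnitalCStarAlgebra D] where
  toE : E →ₗ[ℂ] D
  toA : A →⋆ₙₐ[ℂ] D
  inner_eq : ∀ ξ η : E, star (toE ξ) * toE η = toA (inner A ξ η)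
  left_eq : ∀ (a : A) (ξ : E), toE (φ.toHom a ξ) = toA a * toE ξ

namespace Representation

variable {φ : LeftAction A E} {D : Type w} [NonUnitalCStarAlgebra D] (ρ : Representation φ D)

theorem norm_toA_le (a : A) : ‖ρ.toA a‖ ≤ ‖a‖ := NonUnitalStarAlgHom.norm_apply_le ρ.toA a

theorem norm_toE_le (ξ : E) : ‖ρ.toE ξ‖ ≤ ‖ξ‖ := by
  have h : ‖ρ.toE ξ‖ ^ 2 ≤ ‖ξ‖ ^ 2 := by
    rw [CStarModule.norm_sq_eq A (E := E), sq, ← CStarRing.norm_star_mul_self, ρ.inner_eq]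
    exact ρ.norm_toA_le _
  exact (pow_le_pow_iff_left₀ (norm_nonneg _) (norm_nonneg _) two_ne_zero).1 h

theorem toE_op_smul (a : A) (ξ : E) : ρ.toE (a • ξ) = ρ.toE ξ * ρ.toA a := by
  have key : ∀ η, star (ρ.toE η) * (ρ.toE (a • ξ) - ρ.toE ξ * ρ.toA a) = 0 := fun η => by
    rw [mul_sub, ← mul_assoc, ρ.inner_eq, ρ.inner_eq, CStarModule.inner_op_smul_right, map_mul,
      ← map_mul, ← map_mul, mul_comm, sub_self]
  rw [← sub_eq_zero, ← CStarRing.star_mul_self_eq_zero_iff, star_sub, sub_mul, key, star_mul,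
    mul_assoc, key, mul_zero, sub_zero]

/-- The formal sum `∑ c (ξ, η)` evaluated to `∑ c θ_{ξ,η}`. -/
def thetaSum : (E × E →₀ ℂ) →ₗ[ℂ] compacts A E :=
  Finsupp.linearCombination ℂ fun p : E × E => (⟨theta A p.1 p.2, theta_mem _ _⟩ : compacts A E)

/-- The formal sum `∑ c (ξ, η)` evaluated to `∑ c ρ(ξ) ρ(η)⋆`. -/
def imageSum : (E × E →₀ ℂ) →ₗ[ℂ] D :=
  Finsupp.linearCombination ℂ fun p : E × E => ρ.toE p.1 * star (ρ.toE p.2)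

/-- The `⋆`-homomorphism `ρ⁺ : 𝒦(E) → D` determined by `ρ⁺(θ_{ξ,η}) = ρ(ξ) ρ(η)⋆`, constructed as
the continuous linear extension of this assignment. -/
def plus : compacts A E →L[ℂ] D := ρ.imageSum.extendOfNorm (thetaSum (A := A) (E := E))

theorem denseRange_thetaSum : DenseRange (thetaSum (A := A) (E := E)) := by
  intro x
  have hx : (x : E →L[ℂ] E) ∈
      closure ((Submodule.span ℂ (Set.range fun p : E × E => theta A p.1 p.2) :
        Submodule ℂ (E →L[ℂ] E)) : Set (E →L[ℂ] E)) := x.2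
  rw [closure_subtype]
  refine closure_mono ?_ hx
  intro y hy
  rw [SetLike.mem_coe, Finsupp.mem_span_range_iff_exists_finsupp] at hy
  obtain ⟨c, rfl⟩ := hy
  refine ⟨thetaSum c, ⟨c, rfl⟩, ?_⟩
  simp [thetaSum, Finsupp.linearCombination_apply, Finsupp.sum]

theorem imageSum_mul (f : E × E →₀ ℂ) (ζ : E) :
    ρ.imageSum f * ρ.toE ζ = ρ.toE ((thetaSum (A := A) f : E →L[ℂ] E) ζ) := by
  induction f using Finsupp.induction_linear with
  | zero => simp
  | add f g hf hg => simp [add_mul, hf, hg]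
  | single p c =>
    simp [imageSum, thetaSum, mul_assoc, ρ.inner_eq, toE_op_smul, smul_mul_assoc]

theorem exists_adjoint (f : E × E →₀ ℂ) : ∃ T : E →L[ℂ] E,
    (∀ ξ η, inner A ((thetaSum (A := A) f : E →L[ℂ] E) ξ) η = inner A ξ (T η)) ∧
    ∀ ζ, star (ρ.imageSum f) * ρ.toE ζ = ρ.toE (T ζ) := by
  induction f using Finsupp.induction_linear with
  | zero => exact ⟨0, by simp, by simp⟩
  | add f g hf hg =>
    obtain ⟨S, hS, hS'⟩ := hf
    obtain ⟨T, hT, hT'⟩ := hg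
    exact ⟨S + T, by simp [hS, hT], by simp [add_mul, hS', hT']⟩
  | single p c =>
    refine ⟨star c • theta A p.2 p.1, fun ξ η => ?_, fun ζ => ?_⟩
    · simp [thetaSum, mul_comm]
    · simp [imageSum, mul_assoc, ρ.inner_eq, toE_op_smul, smul_mul_assoc]

theorem exists_bound (f : E × E →₀ ℂ) : ∃ C : ℝ, ∀ (d : D) (T : E →L[ℂ] E),
    (∀ ζ, d * ρ.toE ζ = ρ.toE (T ζ)) → ‖d * ρ.imageSum f‖ ≤ C * ‖T‖ := by
  induction f using Finsupp.induction_linear with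
  | zero => exact ⟨0, by simp⟩
  | add f g hf hg =>
    obtain ⟨C, hC⟩ := hf
    obtain ⟨C', hC'⟩ := hg
    refine ⟨C + C', fun d T h => ?_⟩
    rw [map_add, mul_add, add_mul]
    exact (norm_add_le _ _).trans (add_le_add (hC d T h) (hC' d T h))
  | single p c =>
    refine ⟨‖c‖ * (‖p.1‖ * ‖p.2‖), fun d T h => ?_⟩
    have : d * ρ.imageSum (Finsupp.single p c) = c • (ρ.toE (T p.1) * star (ρ.toE p.2)) := by
      simp [imageSum, ← h, mul_assoc, mul_smul_comm]
    rw [this, norm_smul]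
    calc ‖c‖ * ‖ρ.toE (T p.1) * star (ρ.toE p.2)‖
        ≤ ‖c‖ * ((‖T‖ * ‖p.1‖) * ‖p.2‖) := by
          gcongr
          refine (norm_mul_le _ _).trans ?_
          rw [norm_star]
          gcongr
          · exact (ρ.norm_toE_le _).trans (T.le_opNorm _)
          · exact ρ.norm_toE_le _
      _ = ‖c‖ * (‖p.1‖ * ‖p.2‖) * ‖T‖ := by ring

theorem le_of_pow_bound {x y a C : ℝ} (hy : 0 ≤ y) (ha : 0 < a)
    (h : ∀ m : ℕ, x ^ 2 ^ m * a ≤ C * y ^ 2 ^ m) : x ≤ y := by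
  by_contra! hlt
  have hx0 : 0 < x := hy.trans_lt hlt
  have hlim : Filter.Tendsto (fun m : ℕ => C * (y / x) ^ 2 ^ m) Filter.atTop (nhds (C * 0)) :=
    ((tendsto_pow_atTop_nhds_zero_of_lt_one (by positivity) ((div_lt_one hx0).2 hlt)).comp
      (tendsto_pow_atTop_atTop_of_one_lt one_lt_two)).const_mul C
  have := ge_of_tendsto' (b := a) hlim fun m => by
    rw [div_pow, ← mul_div_assoc, le_div_iff₀ (by positivity), mul_comm]
    exact h m
  simp at this
  linarith

theorem norm_imageSum_le (f : E × E →₀ ℂ) :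
    ‖ρ.imageSum f‖ ≤ 1 * ‖thetaSum (A := A) f‖ := by
  set c := ρ.imageSum f with hc
  set k : E →L[ℂ] E := (thetaSum (A := A) f : E →L[ℂ] E) with hk
  obtain ⟨k', hk', hk''⟩ := ρ.exists_adjoint f
  obtain ⟨C, hC⟩ := ρ.exists_bound f
  rcases eq_or_ne c 0 with h0 | h0
  · rw [h0]; simp
  have hk'norm : ‖k'‖ ≤ ‖k‖ := by
    refine ContinuousLinearMap.opNorm_le_bound _ (norm_nonneg _) fun η => ?_
    have h : ‖k' η‖ ^ 2 ≤ ‖k‖ * ‖η‖ * ‖k' η‖ := by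
      rw [CStarModule.norm_sq_eq A, ← hk']
      refine (CStarModule.norm_inner_le E).trans ?_
      calc ‖k (k' η)‖ * ‖η‖ ≤ (‖k‖ * ‖k' η‖) * ‖η‖ := by gcongr; exact k.le_opNorm _
        _ = _ := by ring
    rcases (norm_nonneg (k' η)).eq_or_lt with h1 | h1
    · rw [← h1]; positivity
    · rw [sq] at h; exact le_of_mul_le_mul_right h h1
  have hcp : 0 < ‖c‖ := norm_pos_iff.2 h0
  have hstep : ∀ m : ℕ, ∃ (e : D) (T : E →L[ℂ] E), IsSelfAdjoint (c * e) ∧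
      ‖c * e‖ = (‖c‖ ^ 2) ^ 2 ^ m ∧ ‖e‖ * ‖c‖ ^ 2 ≤ ‖c‖ * (‖c‖ ^ 2) ^ 2 ^ m ∧
      (∀ ζ, c * e * ρ.toE ζ = ρ.toE (T ζ)) ∧ ‖T‖ ≤ (‖k‖ ^ 2) ^ 2 ^ m := by
    intro m
    induction m with
    | zero =>
      refine ⟨star c, k * k', IsSelfAdjoint.mul_star_self c, ?_, ?_, fun ζ => ?_, ?_⟩
      · rw [CStarRing.norm_self_mul_star]; ring
      · rw [norm_star]; simp
      · rw [mul_assoc, hk'', ρ.imageSum_mul]; rfl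
      · refine (norm_mul_le _ _).trans ?_
        calc ‖k‖ * ‖k'‖ ≤ ‖k‖ * ‖k‖ := by gcongr
          _ = _ := by ring
    | succ m ih =>
      obtain ⟨e, T, h1, h2, h3, h4, h5⟩ := ih
      refine ⟨e * (c * e), T * T, ?_, ?_, ?_, fun ζ => ?_, ?_⟩
      · rw [← mul_assoc, IsSelfAdjoint, star_mul, h1.star_eq]
      · rw [← mul_assoc]
        nth_rewrite 1 [← h1.star_eq]
        rw [CStarRing.norm_star_mul_self, h2, pow_succ 2 m, pow_mul]; ring
      · calc ‖e * (c * e)‖ * ‖c‖ ^ 2 ≤ (‖e‖ * ‖c * e‖) * ‖c‖ ^ 2 := by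
              gcongr; exact norm_mul_le _ _
          _ = (‖e‖ * ‖c‖ ^ 2) * ‖c * e‖ := by ring
          _ ≤ (‖c‖ * (‖c‖ ^ 2) ^ 2 ^ m) * ‖c * e‖ := by gcongr
          _ = ‖c‖ * (‖c‖ ^ 2) ^ 2 ^ (m + 1) := by rw [h2, pow_succ 2 m, pow_mul]; ring
      · rw [← mul_assoc c, mul_assoc (c * e), h4, h4]; rfl
      · refine (norm_mul_le _ _).trans ?_
        calc ‖T‖ * ‖T‖ ≤ (‖k‖ ^ 2) ^ 2 ^ m * (‖k‖ ^ 2) ^ 2 ^ m := by gcongr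
          _ = _ := by rw [pow_succ 2 m, pow_mul _ (2 ^ m) 2]; ring
  have hC0 : 0 ≤ C * ‖k * k'‖ := (norm_nonneg _).trans (hC (c * star c) (k * k') fun ζ => by
    rw [mul_assoc, hk'', ρ.imageSum_mul]; rfl)
  have hmain : ‖c‖ ^ 2 ≤ ‖k‖ ^ 2 := by
    refine le_of_pow_bound (a := ‖c‖) (C := |C|) (by positivity)
      hcp fun m => ?_
    obtain ⟨e, T, h1, h2, h3, h4, h5⟩ := hstep m
    have hb : ‖c * e * c‖ ≤ |C| * (‖k‖ ^ 2) ^ 2 ^ m :=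
      (hC _ T h4).trans (mul_le_mul (le_abs_self C) h5 (norm_nonneg _) (abs_nonneg C))
    have hlow : (‖c‖ ^ 2) ^ 2 ^ m * (‖c‖ ^ 2) ^ 2 ^ m * ‖c‖ ^ 2 ≤
        ‖c * e * c‖ * (‖c‖ * (‖c‖ ^ 2) ^ 2 ^ m) := by
      calc (‖c‖ ^ 2) ^ 2 ^ m * (‖c‖ ^ 2) ^ 2 ^ m * ‖c‖ ^ 2
          = ‖(c * e) * (c * e)‖ * ‖c‖ ^ 2 := by
            nth_rewrite 2 [← h1.star_eq]
            rw [CStarRing.norm_self_mul_star, h2]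
        _ ≤ (‖c * e * c‖ * ‖e‖) * ‖c‖ ^ 2 := by
            gcongr; rw [← mul_assoc]; exact norm_mul_le _ _
        _ = ‖c * e * c‖ * (‖e‖ * ‖c‖ ^ 2) := by ring
        _ ≤ _ := by gcongr
    refine le_trans ?_ hb
    have hpos : 0 < ‖c‖ * (‖c‖ ^ 2) ^ 2 ^ m := by positivity
    refine le_of_mul_le_mul_right ?_ hpos
    calc _ = (‖c‖ ^ 2) ^ 2 ^ m * (‖c‖ ^ 2) ^ 2 ^ m * ‖c‖ ^ 2 := by ring
      _ ≤ _ := hlow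
  rw [one_mul]
  exact (pow_le_pow_iff_left₀ (norm_nonneg _) (norm_nonneg _) two_ne_zero).1 hmain

@[simp]
theorem plus_theta (ξ η : E) :
    ρ.plus ⟨theta A ξ η, theta_mem ξ η⟩ = ρ.toE ξ * star (ρ.toE η) := by
  have h := LinearMap.extendOfNorm_eq (f := ρ.imageSum) (denseRange_thetaSum (A := A) (E := E))
    ⟨1, ρ.norm_imageSum_le⟩ (Finsupp.single (ξ, η) 1)
  simpa [thetaSum, imageSum, plus] using h

theorem plus_unique (g : compacts A E →L[ℂ] D)
    (hg : ∀ ξ η, g ⟨theta A ξ η, theta_mem ξ η⟩ = ρ.toE ξ * star (ρ.toE η)) : ρ.plus = g := by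
  refine LinearMap.extendOfNorm_unique (denseRange_thetaSum (A := A) (E := E)) 1
    ρ.norm_imageSum_le g ?_
  ext p
  simp [thetaSum, imageSum, hg]

end Representation

/-- A covariant representation of the correspondence `E` on a `C⋆`-algebra `D`. -/
structure CovariantRep (φ : LeftAction A E) (D : Type w) [NonUnitalCStarAlgebra D] extends
    Representation φ D where
  covariant : ∀ (a : A) (ha : a ∈ katsuraIdeal φ),
    toRepresentation.plus ⟨φ.toHom a, ha.1⟩ = toA a

/-- A covariant representation together with the `C⋆`-algebra on which it lives.  This universe of
algebras is large enough: the `C⋆`-algebra generated by the image of a covariant representation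
on an arbitrary `C⋆`-algebra has a copy in it. -/
structure AnyCovariantRep (φ : LeftAction A E) where
  D : Type (max u v)
  [alg : NonUnitalCStarAlgebra D]
  rep : CovariantRep φ D

instance (φ : LeftAction A E) (i : AnyCovariantRep φ) : NonUnitalCStarAlgebra i.D := i.alg

/-- The `C⋆`-algebra of bounded families indexed by all covariant representations. -/
abbrev BoundedFamilies (φ : LeftAction A E) := lp (fun i : AnyCovariantRep φ => i.D) ⊤

variable (φ : LeftAction A E)

/-- The direct sum of all covariant representations, on the module. -/
def sumE : E →ₗ[ℂ] BoundedFamilies φ where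
  toFun ξ := ⟨fun i => i.rep.toE ξ, memℓp_infty
    ⟨‖ξ‖, by rintro _ ⟨i, rfl⟩; exact i.rep.norm_toE_le ξ⟩⟩
  map_add' ξ η := by ext i; simp; rfl
  map_smul' c ξ := by ext i; simp

/-- The direct sum of all covariant representations, on the coefficient algebra. -/
def sumA : A →⋆ₙₐ[ℂ] BoundedFamilies φ where
  toFun a := ⟨fun i => i.rep.toA a, memℓp_infty
    ⟨‖a‖, by rintro _ ⟨i, rfl⟩; exact i.rep.norm_toA_le a⟩⟩
  map_add' a b := by ext i; simp; rfl
  map_smul' c a := by ext i; simp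
  map_zero' := by ext i; simp
  map_mul' a b := by ext i; simp
  map_star' a := by ext i; simp [map_star]

/-- The `C⋆`-algebra `𝒪_E` of the correspondence: the `C⋆`-algebra generated by the image of
the universal covariant representation. -/
def katsuraAlgebra : NonUnitalStarSubalgebra ℂ (BoundedFamilies φ) :=
  (NonUnitalStarAlgebra.adjoin ℂ (Set.range (sumE φ) ∪ Set.range (sumA φ))).topologicalClosure

/-- `𝒪_E` as a type. -/
abbrev O : Type (max u v + 1) := katsuraAlgebra φ

instance : IsClosed (katsuraAlgebra φ : Set (BoundedFamilies φ)) :=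
  NonUnitalStarSubalgebra.isClosed_topologicalClosure _

instance : NonUnitalCStarAlgebra (O φ) :=
  NonUnitalStarSubalgebra.nonUnitalCStarAlgebra (katsuraAlgebra φ)

theorem sumE_mem (ξ : E) : sumE φ ξ ∈ katsuraAlgebra φ :=
  NonUnitalStarSubalgebra.le_topologicalClosure _
    (NonUnitalStarAlgebra.subset_adjoin ℂ _ (Or.inl ⟨ξ, rfl⟩))

theorem sumA_mem (a : A) : sumA φ a ∈ katsuraAlgebra φ :=
  NonUnitalStarSubalgebra.le_topologicalClosure _
    (NonUnitalStarAlgebra.subset_adjoin ℂ _ (Or.inr ⟨a, rfl⟩))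

/-- The universal representation, before covariance is recorded. -/
def universalRep₀ : Representation φ (O φ) where
  toE := (sumE φ).codRestrict (katsuraAlgebra φ).toSubmodule (sumE_mem φ)
  toA := NonUnitalStarAlgHom.codRestrict (sumA φ) (katsuraAlgebra φ) (sumA_mem φ)
  inner_eq ξ η := by
    ext i
    exact i.rep.inner_eq ξ η
  left_eq a ξ := by
    ext i
    exact i.rep.left_eq a ξ

/-- Evaluation of an element of `𝒪_E` in a covariant representation. -/
def evalRep (i : AnyCovariantRep φ) : O φ →⋆ₙₐ[ℂ] i.D where
  toFun x := (x : BoundedFamilies φ) i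
  map_add' _ _ := rfl
  map_smul' _ _ := rfl
  map_zero' := rfl
  map_mul' _ _ := rfl
  map_star' _ := rfl

/-- The universal covariant representation `(π_E, π_A)` of `E` on `𝒪_E`. -/
def universalRep : CovariantRep φ (O φ) where
  toRepresentation := universalRep₀ φ
  covariant a ha := by
    ext i
    have hcont : Continuous (evalRep φ i) :=
      AddMonoidHomClass.continuous_of_bound (evalRep φ i) 1 fun x => by
        rw [one_mul]; exact NonUnitalStarAlgHom.norm_apply_le (evalRep φ i) x
    have h := i.rep.plus_unique
      ((⟨(evalRep φ i : O φ →ₗ[ℂ] i.D), hcont⟩ : O φ →L[ℂ] i.D).comp (universalRep₀ φ).plus)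
      fun ξ η => by
        simp only [ContinuousLinearMap.comp_apply, Representation.plus_theta]
        rfl
    have h' := i.rep.covariant a ha
    rw [h] at h'
    exact h'

/-- The universal property of `𝒪_E`: existence. -/
theorem exists_lift {D : Type (max u v)} [NonUnitalCStarAlgebra D] (ρ : CovariantRep φ D) :
    ∃ Ψ : O φ →⋆ₙₐ[ℂ] D, (∀ ξ, Ψ ((universalRep φ).toE ξ) = ρ.toE ξ) ∧
      ∀ a, Ψ ((universalRep φ).toA a) = ρ.toA a :=
  ⟨evalRep φ ⟨D, ρ⟩, fun _ => rfl, fun _ => rfl⟩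

end General

section Diagonal

/-! ### Direct sums of principal ideals

For a commutative unital `C⋆`-algebra `B`, a finite family `p e` in `B` and `⋆`-homomorphisms
`l e : B → B`, the Hilbert module `⨁ e, p e B` with `⟨ξ, η⟩ = ∑ e, ξ_e⋆ η_e` and the left action
`(φ b ξ)_e = l_e(b) ξ_e`. -/

open WithCStarModule

variable {B : Type u} [CommCStarAlgebra B] [PartialOrder B] [StarOrderedRing B]
  {ι : Type v} [Fintype ι]

/-- The module `⨁ e, p e B` (for projections `p e`). -/
def DiagModule (p : ι → B) : Submodule ℂ C⋆ᵐᵒᵈ(B, ι → B) where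
  carrier := {ξ | ∀ e, p e * ξ e = ξ e}
  add_mem' {ξ η} hξ hη e := by simp [mul_add, hξ e, hη e]
  zero_mem' e := by simp
  smul_mem' c ξ hξ e := by simp [hξ e]

variable (p : ι → B)

theorem continuous_coord (e : ι) : Continuous fun ξ : C⋆ᵐᵒᵈ(B, ι → B) => ξ e :=
  (continuous_apply e).comp (equivL (R := ℂ) (A := B) (E := ι → B)).continuous

instance : CompleteSpace (DiagModule p) := by
  refine IsClosed.completeSpace_coe (hs := ?_)
  have : ((DiagModule p : Submodule ℂ C⋆ᵐᵒᵈ(B, ι → B)) : Set C⋆ᵐᵒᵈ(B, ι → B)) =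
      ⋂ e, {ξ | p e * ξ e = ξ e} := by ext; simp [DiagModule]
  rw [this]
  exact isClosed_iInter fun e => isClosed_eq
    (continuous_const.mul (continuous_coord e)) (continuous_coord e)

instance : SMul B (DiagModule p) where
  smul b ξ := ⟨b • (ξ : C⋆ᵐᵒᵈ(B, ι → B)), fun e => by
    simp [mul_left_comm (p e) b, ξ.2 e]⟩

theorem coe_op_smul (b : B) (ξ : DiagModule p) :
    ((b • ξ : DiagModule p) : C⋆ᵐᵒᵈ(B, ι → B)) = b • (ξ : C⋆ᵐᵒᵈ(B, ι → B)) := rfl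

instance : CStarModule B (DiagModule p) where
  inner ξ η := inner B (ξ : C⋆ᵐᵒᵈ(B, ι → B)) (η : C⋆ᵐᵒᵈ(B, ι → B))
  inner_add_right := CStarModule.inner_add_right
  inner_self_nonneg := CStarModule.inner_self_nonneg
  inner_self {ξ} := CStarModule.inner_self.trans (by simp)
  inner_op_smul_right := CStarModule.inner_op_smul_right
  inner_smul_right_complex := CStarModule.inner_smul_right_complex
  star_inner _ _ := CStarModule.star_inner _ _
  norm_eq_sqrt_norm_inner_self ξ :=
    CStarModule.norm_eq_sqrt_norm_inner_self (A := B) (ξ : C⋆ᵐᵒᵈ(B, ι → B))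

theorem diag_inner (ξ η : DiagModule p) :
    inner B ξ η = ∑ e, star ((ξ : C⋆ᵐᵒᵈ(B, ι → B)) e) * (η : C⋆ᵐᵒᵈ(B, ι → B)) e :=
  Finset.sum_congr rfl fun _ _ => mul_comm _ _

variable {p} in
theorem diag_ext {ξ η : DiagModule p}
    (h : ∀ e, (ξ : C⋆ᵐᵒᵈ(B, ι → B)) e = (η : C⋆ᵐᵒᵈ(B, ι → B)) e) : ξ = η :=
  Subtype.ext (WithCStarModule.ext h)

/-- The operator `ξ ↦ (c_e ξ_e)_e` on `⨁ e, p e B`. -/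
def diagOp (c : ι → B) : DiagModule p →L[ℂ] DiagModule p where
  toFun ξ := ⟨(equiv B (ι → B)).symm fun e => c e * (ξ : C⋆ᵐᵒᵈ(B, ι → B)) e,
    fun e => by simp [mul_left_comm (p e), ξ.2 e]⟩
  map_add' ξ η := diag_ext fun e => by simp [mul_add]
  map_smul' z ξ := diag_ext fun e => by simp
  cont := by
    refine Continuous.subtype_mk ?_ _
    refine (equivL (R := ℂ) (A := B) (E := ι → B)).symm.continuous.comp ?_
    exact continuous_pi fun e => continuous_const.mul
      ((continuous_coord e).comp continuous_subtype_val)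

theorem diagOp_apply (c : ι → B) (ξ : DiagModule p) (e : ι) :
    (diagOp p c ξ : C⋆ᵐᵒᵈ(B, ι → B)) e = c e * (ξ : C⋆ᵐᵒᵈ(B, ι → B)) e := rfl

/-- The left action `(φ b ξ)_e = l_e(b) ξ_e` on `⨁ e, p e B`. -/
def diagAction (l : ι → B →⋆ₐ[ℂ] B) : LeftAction B (DiagModule p) where
  toHom :=
    { toFun := fun b => diagOp p fun e => l e b
      map_smul' := fun c b => ContinuousLinearMap.ext fun ξ => diag_ext fun e =>
        show l e (c • b) * _ = c • (l e b * _) by rw [map_smul, smul_mul_assoc]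
      map_zero' := ContinuousLinearMap.ext fun ξ => diag_ext fun e =>
        show l e 0 * _ = 0 by rw [map_zero, zero_mul]
      map_add' := fun b c => ContinuousLinearMap.ext fun ξ => diag_ext fun e =>
        show l e (b + c) * _ = l e b * _ + l e c * _ by rw [map_add, add_mul]
      map_mul' := fun b c => ContinuousLinearMap.ext fun ξ => diag_ext fun e =>
        show l e (b * c) * _ = l e b * (l e c * _) by rw [map_mul, mul_assoc] }
  adjoint b ξ η := by
    rw [diag_inner, diag_inner]
    refine Finset.sum_congr rfl fun e _ => ?_
    change star (l e b * _) * _ = _ * (l e (star b) * _)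
    rw [map_star, star_mul]
    ring

end Diagonal

/-! ### The two correspondences -/

namespace QuantumDisc

open WithCStarModule OnePoint Filter Topology

/-- The vertices `v_1, …, v_{n+1}` of the graph `M_n`, as the integers `1, …, n + 1`. -/
abbrev V (n : ℕ) : Type := Finset.Icc 1 (n + 1)

open Classical in
/-- The element of `⨁ e, p e B` with component `p e` for the indices `e` in `s`, and `0` for the
other indices. -/
def gen {B ι : Type} [CommCStarAlgebra B] [PartialOrder B] [StarOrderedRing B] [Fintype ι]
    {p : ι → B} (hp : ∀ e, p e * p e = p e) (s : ι → Prop) : DiagModule p :=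
  ⟨(equiv B (ι → B)).symm fun e => if s e then p e else 0, fun e => by
    by_cases h : s e <;> simp [h, hp]⟩

section X

variable (n : ℕ)

/-- The coefficient algebra `A = ℂ^{n+1}`. -/
abbrev A : Type := V n → ℂ

/-- The minimal projection `P_i` of `A`, for `1 ≤ i ≤ n + 1`. -/
def P (i : ℕ) : A n := fun v => if (v : ℕ) = i then 1 else 0

/-- The edges `e_{i,j}` of `M_n`, from `v_i` to `v_j`, with `1 ≤ i ≤ n` and `i ≤ j ≤ n + 1`. -/
abbrev EdgeX : Type := {e : V n × V n // (e.1 : ℕ) ≤ n ∧ (e.1 : ℕ) ≤ e.2}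

/-- The projection `⟨w_{i,j}, w_{i,j}⟩ = P_j` attached to the edge `e_{i,j}`. -/
def projX (e : EdgeX n) : A n := P n e.1.2

theorem projX_mul_self (e : EdgeX n) : projX n e * projX n e = projX n e := by
  ext v; simp [projX, P]

/-- The module `X = ⨁_{i,j} w_{i,j} A`, with `w_{i,j} A = ℂ w_{i,j}`. -/
abbrev X : Type := DiagModule (projX n)

/-- The basis vector `w_{i,j}` of `X`, for `1 ≤ i ≤ n` and `i ≤ j ≤ n + 1`. -/
def w (i j : ℕ) : X n := gen (projX_mul_self n) fun e => (e.1.1 : ℕ) = i ∧ (e.1.2 : ℕ) = j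

/-- The left action on `X`: `a` acts on `w_{i,j}` as multiplication by its `i`-th coordinate. -/
def actionX : LeftAction (A n) (X n) :=
  diagAction (projX n) fun e =>
    (StarAlgHom.ofId ℂ (A n)).comp (Pi.evalStarAlgHom ℂ (fun _ : V n => ℂ) e.1.1)

/-- The `C⋆`-algebra `𝒪_X`. -/
abbrev OX : Type 1 := O (actionX n)

/-- `π_X : X → 𝒪_X`. -/
def piX : X n →ₗ[ℂ] OX n := (universalRep (actionX n)).toE

/-- `π_A : A → 𝒪_X`. -/
def piA : A n →⋆ₙₐ[ℂ] OX n := (universalRep (actionX n)).toA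

/-- The element `s = π_X(w_{n,n}) + π_X(w_{n,n+1})` of `𝒪_X`. -/
def s : OX n := piX n (w n n n) + piX n (w n n (n + 1))

/-- The elements `a_j = s^j π_A(P_{n+1}) (s⋆)^j` of `𝒪_X`. -/
def a : ℕ → OX n
  | 0 => piA n (P n (n + 1))
  | j + 1 => s n * a j * star (s n)

end X

section Y

variable (n : ℕ)

/-- The spectrum of `B`: an isolated point for each `R_i` with `i ≠ n`, and, under `R_n`, a
convergent sequence of isolated points, one for each `Q_j` with `j ≥ 1`, with its limit. -/
abbrev K : Type := {v : V n // (v : ℕ) ≠ n} ⊕ OnePoint ℕ+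

/-- The `C⋆`-algebra `B` generated by the projections `R_i` and `Q_j`. -/
abbrev B : Type := C(K n, ℂ)

/-- The projection `R_i` of `B`, for `1 ≤ i ≤ n + 1`. -/
def R (i : ℕ) : B n where
  toFun := Sum.elim (fun v => if (v.1 : ℕ) = i then 1 else 0) fun _ => if i = n then 1 else 0
  continuous_toFun := continuous_of_discreteTopology.sumElim continuous_const

/-- The projection `Q_j ≤ R_n` of `B`, for `j ≥ 1`. -/
def Q (j : ℕ+) : B n where
  toFun := Sum.elim (fun _ => 0) fun t => t.elim 0 fun k => if k = j then 1 else 0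
  continuous_toFun := continuous_const.sumElim <| (continuous_iff_from_discrete _).2 <| by
    refine tendsto_const_nhds.congr' ?_
    filter_upwards [(Set.finite_singleton j).compl_mem_cofinite] with k hk
    have : k ≠ j := hk
    simp [this]

/-- The indices of the generators `x_{i,j}` (`1 ≤ i ≤ n - 1`, `i ≤ j ≤ n + 1`) and, as `none`,
`y` of the Hilbert module `Y`. -/
abbrev EdgeY : Type := Option {e : V n × V n // (e.1 : ℕ) < n ∧ (e.1 : ℕ) ≤ e.2}

/-- The projections `⟨x_{i,j}, x_{i,j}⟩ = R_j` and `⟨y, y⟩ = R_n`. -/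
def projY : EdgeY n → B n
  | .some e => R n e.1.2
  | .none => R n n

theorem R_mul_self (i : ℕ) : R n i * R n i = R n i := by
  ext (v | t) <;> simp [R]

theorem projY_mul_self (e : EdgeY n) : projY n e * projY n e = projY n e := by
  rcases e with _ | e
  · exact R_mul_self n n
  · exact R_mul_self n _

/-- The module `Y`, which is the direct sum of the submodules `x_{i,j} B ≅ R_j B` and
`y B ≅ R_n B`. -/
abbrev Y : Type := DiagModule (projY n)

/-- The generator `x_{i,j}` of `Y`, for `1 ≤ i ≤ n - 1` and `i ≤ j ≤ n + 1`. -/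
def x (i j : ℕ) : Y n :=
  gen (projY_mul_self n) fun
    | .some e => (e.1.1 : ℕ) = i ∧ (e.1.2 : ℕ) = j
    | .none => False

/-- The generator `y` of `Y`. -/
def y : Y n := gen (projY_mul_self n) fun e => e = none

/-- The generator `x_{i,n,j} = x_{i,n} Q_j` of `Y`. -/
def xn (i : ℕ) (j : ℕ+) : Y n := Q n j • x n i n

/-- The generator `y' = y Q_1` of `Y`. -/
def yPrime : Y n := Q n 1 • y n

/-- The generator `y_i = y Q_{i+1}` of `Y`, for `i ≥ 1`. -/
def ys (i : ℕ+) : Y n := Q n (i + 1) • y n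

/-- The map of `K` which sends the point of `Q_1` to the point of `R_{n+1}`, the point of `Q_{k+1}`
to the point of `Q_k`, and fixes the limit point.  (Its values outside the support of `R_n` do not
matter below.) -/
def shift : C(K n, K n) where
  toFun := Sum.elim Sum.inl (continuousMapMkDiscrete
    (fun k : ℕ+ => if k = 1 then Sum.inl ⟨⟨n + 1, by simp⟩, n.succ_ne_self⟩
      else Sum.inr ((k - 1 : ℕ+) : OnePoint ℕ+)) (Sum.inr ∞) (by
        have h1 : Tendsto (fun k : ℕ+ => k - 1) cofinite cofinite := by
          refine Tendsto.cofinite_of_finite_preimage_singleton fun m => ?_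
          refine (Set.finite_Icc 1 (m + 1)).subset fun k hk => ?_
          have hk : k - 1 = m := hk
          subst hk
          refine ⟨one_le, ?_⟩
          rcases eq_or_ne k 1 with rfl | h
          · decide
          · rw [PNat.sub_add_of_lt (lt_of_le_of_ne one_le h.symm)]
        have h2 : Tendsto (fun k : ℕ+ => (k : OnePoint ℕ+)) cofinite (𝓝 ∞) :=
          (continuous_iff_from_discrete id).1 continuous_id
        refine Tendsto.congr' ?_ ((continuous_inr.tendsto _).comp (h2.comp h1))
        filter_upwards [(Set.finite_singleton 1).compl_mem_cofinite] with k hk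
        have : k ≠ 1 := hk
        simp [this]))
  continuous_toFun := continuous_inl.sumElim (ContinuousMap.continuous _)

/-- The left action on `Y`: `b` acts on `x_{i,j} B` as multiplication by its value at the point of
`R_i`, and on `y B` as multiplication by `b ∘ shift`. -/
def actionY : LeftAction (B n) (Y n) :=
  diagAction (projY n) fun
    | .some e => (StarAlgHom.ofId ℂ (B n)).comp
        (ContinuousMap.evalStarAlgHom ℂ ℂ (Sum.inl ⟨e.1.1, e.2.1.ne⟩ : K n))
    | .none => (shift n).compStarAlgHom' ℂ ℂ

/-- The `C⋆`-algebra `𝒪_Y`. -/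
abbrev OY : Type 1 := O (actionY n)

/-- `π_Y : Y → 𝒪_Y`. -/
def piY : Y n →ₗ[ℂ] OY n := (universalRep (actionY n)).toE

/-- `π_B : B → 𝒪_Y`. -/
def piB : B n →⋆ₙₐ[ℂ] OY n := (universalRep (actionY n)).toA

end Y

section Relations

/-! ### The defining relations

The inner products, right actions and left actions of the generators; those involving `x_{i,n,j}`,
`y'` and `y_i` follow from these, as `x_{i,n,j} = x_{i,n} Q_j`, `y' = y Q_1`, `y_i = y Q_{i+1}`. -/

section gen

variable {B ι : Type} [CommCStarAlgebra B] [PartialOrder B] [StarOrderedRing B] [Fintype ι]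
  {p : ι → B} (hp : ∀ e, p e * p e = p e) {s t : ι → Prop}

open Classical in
theorem gen_apply (e : ι) :
    (gen hp s : C⋆ᵐᵒᵈ(B, ι → B)) e = if s e then p e else 0 := rfl

theorem gen_smul {b c : B} (h : ∀ e, s e → b * p e = c * p e) :
    b • gen hp s = c • gen hp s := diag_ext fun e => by
  rw [coe_op_smul, coe_op_smul, WithCStarModule.smul_apply, WithCStarModule.smul_apply, gen_apply]
  split_ifs with hs <;> simp_all

theorem gen_inner_of_disjoint (h : ∀ e, s e → ¬ t e) : inner B (gen hp s) (gen hp t) = 0 := by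
  rw [diag_inner]
  refine Finset.sum_eq_zero fun e _ => ?_
  rw [gen_apply, gen_apply]
  by_cases hs : s e <;> simp [hs, h]

theorem gen_inner_self (e : ι) (he : ∀ f, s f ↔ f = e) (hs : star (p e) = p e) :
    inner B (gen hp s) (gen hp s) = p e := by
  rw [diag_inner, Finset.sum_eq_single e]
  · rw [gen_apply, if_pos ((he e).2 rfl), hs, hp]
  · intro f _ hf
    rw [gen_apply, if_neg (by simpa [he] using hf)]; simp
  · simp

theorem gen_left (l : ι → B →⋆ₐ[ℂ] B) {b c : B} (h : ∀ e, s e → l e b * p e = c * p e) :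
    (diagAction p l).toHom b (gen hp s) = c • gen hp s := diag_ext fun e => by
  rw [coe_op_smul, WithCStarModule.smul_apply]
  change l e b * _ = c * _
  rw [gen_apply]
  split_ifs with hs <;> simp_all

end gen

variable {n : ℕ}

theorem inner_w_self {i j : ℕ} (hi : 1 ≤ i) (hin : i ≤ n) (hij : i ≤ j) (hj : j ≤ n + 1) :
    inner (A n) (w n i j) (w n i j) = P n j := by
  refine gen_inner_self (projX_mul_self n)
    (⟨(⟨i, by simp; omega⟩, ⟨j, by simp; omega⟩), hin, hij⟩ : EdgeX n) ?_ ?_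
  · rintro ⟨⟨e, f⟩, h⟩
    simp [Subtype.ext_iff]
  · ext v; simp [projX, P]

theorem inner_w_of_ne {i j k l : ℕ} (h : ¬ (i = k ∧ j = l)) :
    inner (A n) (w n i j) (w n k l) = 0 :=
  gen_inner_of_disjoint _ fun _ h1 h2 => h ⟨h1.1 ▸ h2.1, h1.2 ▸ h2.2⟩

theorem P_smul_w {i j k : ℕ} : P n k • w n i j = (if j = k then 1 else 0 : A n) • w n i j :=
  gen_smul _ fun e he => by
    ext v
    obtain ⟨-, rfl⟩ := he
    by_cases h : (e.1.2 : ℕ) = k <;> simp [P, projX, h] <;> grind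

theorem left_w {i j k : ℕ} :
    (actionX n).toHom (P n k) (w n i j) = (if i = k then 1 else 0 : A n) • w n i j :=
  gen_left _ _ fun e he => by
    ext v
    obtain ⟨rfl, -⟩ := he
    by_cases h : (e.1.1 : ℕ) = k <;> simp [P, projX, h, StarAlgHom.ofId]

theorem star_R (i : ℕ) : star (R n i) = R n i := by
  ext (v | t) <;> simp [R]

theorem inner_x_self {i j : ℕ} (hi : 1 ≤ i) (hin : i < n) (hij : i ≤ j) (hj : j ≤ n + 1) :
    inner (B n) (x n i j) (x n i j) = R n j := by
  refine gen_inner_self (projY_mul_self n)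
    (.some ⟨(⟨i, by simp; omega⟩, ⟨j, by simp; omega⟩), hin, hij⟩ : EdgeY n) ?_ (star_R _)
  rintro (_ | ⟨⟨e, f⟩, h⟩)
  · simp
  · simp [Subtype.ext_iff]

theorem inner_x_of_ne {i j k l : ℕ} (h : ¬ (i = k ∧ j = l)) :
    inner (B n) (x n i j) (x n k l) = 0 :=
  gen_inner_of_disjoint _ fun e => by
    rcases e with _ | e
    · exact fun h => h.elim
    · exact fun h1 h2 => h ⟨h1.1 ▸ h2.1, h1.2 ▸ h2.2⟩

theorem inner_y_self : inner (B n) (y n) (y n) = R n n :=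
  gen_inner_self _ (e := none) (fun _ => Iff.rfl) (star_R _)

theorem inner_x_y {i j : ℕ} : inner (B n) (x n i j) (y n) = 0 :=
  gen_inner_of_disjoint _ fun e => by
    rcases e with _ | e
    · exact fun h => h.elim
    · simp

theorem R_mul_R {i j : ℕ} : R n i * R n j = if i = j then R n i else 0 := by
  ext (v | t) <;> by_cases h : i = j <;> simp [R, h] <;> grind

theorem Q_mul_R {k : ℕ+} {j : ℕ} : Q n k * R n j = if j = n then Q n k else 0 := by
  ext (v | t) <;> by_cases h : j = n <;> simp [R, Q, h]

theorem Q_mul_Q {j k : ℕ+} : Q n j * Q n k = if j = k then Q n j else 0 := by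
  ext (v | t)
  · by_cases h : j = k <;> simp [Q, h]
  · induction t using OnePoint.rec with
    | infty => by_cases h : j = k <;> simp [Q, h]
    | coe t => by_cases h : j = k <;> simp [Q, h]; grind

theorem R_smul_x {i j k : ℕ} : R n k • x n i j = (if j = k then 1 else 0 : B n) • x n i j :=
  gen_smul _ fun e he => by
    rcases e with _ | e
    · exact he.elim
    · obtain ⟨-, rfl⟩ := he
      change R n k * R n _ = _ * R n _
      rw [R_mul_R]
      by_cases h : (e.1.2 : ℕ) = k
      · simp [h]
      · simp [h, Ne.symm h]

theorem Q_smul_x {i j : ℕ} {k : ℕ+} (hj : j ≠ n) : Q n k • x n i j = (0 : B n) • x n i j :=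
  gen_smul _ fun e he => by
    rcases e with _ | e
    · exact he.elim
    · obtain ⟨-, rfl⟩ := he
      change Q n k * R n _ = 0 * R n _
      rw [Q_mul_R, if_neg hj, zero_mul]

theorem R_smul_y {k : ℕ} : R n k • y n = (if n = k then 1 else 0 : B n) • y n :=
  gen_smul _ fun e he => by
    subst he
    change R n k * R n _ = _ * R n _
    rw [R_mul_R]
    by_cases h : n = k
    · simp [← h]
    · simp [h, Ne.symm h]

theorem left_R_x {i j k : ℕ} :
    (actionY n).toHom (R n k) (x n i j) = (if i = k then 1 else 0 : B n) • x n i j :=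
  gen_left _ _ fun e he => by
    rcases e with _ | e
    · exact he.elim
    · obtain ⟨rfl, -⟩ := he
      congr 1
      ext v : 1
      by_cases h : (e.1.1 : ℕ) = k <;> simp [R, h]

theorem left_Q_x {i j : ℕ} {k : ℕ+} :
    (actionY n).toHom (Q n k) (x n i j) = (0 : B n) • x n i j :=
  gen_left _ _ fun e he => by
    rcases e with _ | e
    · exact he.elim
    · congr 1

theorem projY_none_inl (v : {v : V n // (v : ℕ) ≠ n}) : projY n none (Sum.inl v) = 0 :=
  if_neg v.2

theorem shift_infty : shift n (Sum.inr ∞) = Sum.inr ∞ := rfl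

theorem shift_coe (k : ℕ+) : shift n (Sum.inr (k : OnePoint ℕ+)) =
    if k = 1 then Sum.inl ⟨⟨n + 1, by simp⟩, n.succ_ne_self⟩
      else Sum.inr ((k - 1 : ℕ+) : OnePoint ℕ+) := rfl

/-- That is, `φ_Y(R_n) y = y - y'`, `φ_Y(R_{n+1}) y = y'` and `φ_Y(R_k) y = 0` for `k < n`. -/
theorem left_R_y {k : ℕ} : (actionY n).toHom (R n k) (y n) =
    ((if n = k then 1 - Q n 1 else 0) + if n + 1 = k then Q n 1 else 0) • y n :=
  gen_left _ _ fun e he => by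
    subst he
    change (R n k).comp (shift n) * _ = _
    ext (v | t)
    · rw [ContinuousMap.mul_apply, ContinuousMap.mul_apply, projY_none_inl, mul_zero, mul_zero]
    · rw [ContinuousMap.mul_apply, ContinuousMap.mul_apply]
      congr 1
      rw [ContinuousMap.comp_apply]
      induction t using OnePoint.rec with
      | infty => rw [shift_infty]; by_cases h : n = k <;> by_cases h' : n + 1 = k <;>
          simp [R, Q, h, h', eq_comm] <;> omega
      | coe t =>
        rw [shift_coe]
        by_cases ht : t = 1 <;> by_cases h : n = k <;> by_cases h' : n + 1 = k <;>
          simp [R, Q, h, h', ht, eq_comm] <;> omega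

/-- That is, `φ_Y(Q_k) y = y_k`. -/
theorem left_Q_y {k : ℕ+} : (actionY n).toHom (Q n k) (y n) = ys n k :=
  gen_left _ _ fun e he => by
    subst he
    change (Q n k).comp (shift n) * _ = _
    ext (v | t)
    · rw [ContinuousMap.mul_apply, ContinuousMap.mul_apply, projY_none_inl, mul_zero, mul_zero]
    · rw [ContinuousMap.mul_apply, ContinuousMap.mul_apply]
      congr 1
      rw [ContinuousMap.comp_apply]
      induction t using OnePoint.rec with
      | infty => rw [shift_infty]; simp [Q]
      | coe t =>
        rw [shift_coe]
        have key : t ≠ 1 → (t - 1 = k ↔ t = k + 1) := fun ht => by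
          have := PNat.sub_add_of_lt (lt_of_le_of_ne one_le (Ne.symm ht))
          constructor
          · rintro rfl; exact this.symm
          · rintro rfl; simp
        by_cases ht : t = 1
        · have : (1 : ℕ+) ≠ k + 1 := (PNat.lt_add_left 1 k).ne
          simp [Q, ht, this]
        · simp [Q, ht, key ht]

end Relations

end QuantumDisc

end CStarCorr

end

noncomputable section

namespace CStarCorr

universe u v w u' v'

open Filter Topology

-- Homomorphisms out of the algebras `𝒪_E`.

section Functoriality

-- Covariant representations of `X` and of `Y` on one and the same algebra determine each other.
--
-- From `X` to `Y`: the Cuntz–Krieger relations make `s = w_{n,n} + w_{n,n+1}` a partial isometry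
-- with `s⋆s = P_n + P_{n+1}` and `ss⋆ = P_n`. Hence `s` moves `P_{n+1}`, which is orthogonal to the
-- range of `s`, to mutually orthogonal projections `s^j P_{n+1} (s⋆)^j ≤ P_n` for `j ≥ 1`
-- (`tower_mul_tower`). They serve as images of the `Q_j`: a continuous function `b` on `K` goes to
-- `b(∞) 1 + ∑ (b(t) - b(∞)) e_t`, a norm convergent sum because the `e_t` are orthogonal and the
-- coefficients tend to zero (`projectionHom`). Put `y = s⋆`. The left action of `Y` on `y` is then
-- the relation `s⋆ a_{j+1} = a_j s⋆` (`star_isom_mul_range`), and covariance is `sum_genY`.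
--
-- From `Y` to `X`: the left action on `Y` is faithful, so Katsura's ideal is all of `B`, and
-- covariance forces `yy⋆ = R_n + R_{n+1}` (`y_mul_star_y`) as well as the Cuntz–Krieger relations
-- for the `x_{i,j}`. Therefore `w_{n,j} = y⋆ R_j` completes the `x_{i,j}` to a covariant
-- representation of `X`, in which `s = y⋆`. The two passages are inverse to each other since `y⋆
-- R_{n+1} y = Q_1` and `y⋆ Q_k y = Q_{k+1}` (`tower_star_y`), so that the `Q_j` are recovered from
-- `s` and `P_{n+1}`.
--
-- Two general facts support this. Both modules are finite sums of modules `pB`, so the left action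
-- is by finite sums of operators `θ_{ξ,η}` and covariance becomes an algebraic identity
-- (`diag_plus`). Moreover `𝒪_Y` lies one universe above the algebras over which `𝒪_X` is formed, so
-- the universal property is not applied to it directly: both passages commute with homomorphisms,
-- and a homomorphism into `𝒪_Y` is assembled from all representations of `Y` at once
-- (`exists_hom`).

theorem continuous_starHom {C : Type u} {D : Type v} [NonUnitalCStarAlgebra C]
    [NonUnitalCStarAlgebra D] (f : C →⋆ₙₐ[ℂ] D) : Continuous f :=
  AddMonoidHomClass.continuous_of_bound f 1 fun x => by
    rw [one_mul]; exact NonUnitalStarAlgHom.norm_apply_le f x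

variable {A : Type u} {E : Type v} [NonUnitalCommCStarAlgebra A] [PartialOrder A]
  [StarOrderedRing A] [NormedAddCommGroup E] [NormedSpace ℂ E] [CompleteSpace E] [SMul A E]
  [CStarModule A E]
  {B : Type u'} {F : Type v'} [NonUnitalCommCStarAlgebra B] [PartialOrder B]
  [StarOrderedRing B] [NormedAddCommGroup F] [NormedSpace ℂ F] [CompleteSpace F] [SMul B F]
  [CStarModule B F]
  {φ : LeftAction A E} {ψ : LeftAction B F}

/-- A closed star subalgebra whose preimage contains the generators of `𝒪_E` has everything as
preimage. -/
theorem O_induction {D : Type w} [NonUnitalCStarAlgebra D] (f : O φ →⋆ₙₐ[ℂ] D)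
    (S : NonUnitalStarSubalgebra ℂ D) (hS : IsClosed (S : Set D))
    (hE : ∀ ξ, f ((universalRep φ).toE ξ) ∈ S) (hA : ∀ a, f ((universalRep φ).toA a) ∈ S)
    (z : O φ) : f z ∈ S := by
  obtain ⟨z, hz⟩ := z
  have hle : ∀ y (hy : y ∈ NonUnitalStarAlgebra.adjoin ℂ
      (Set.range (sumE φ) ∪ Set.range (sumA φ))),
      f ⟨y, NonUnitalStarSubalgebra.le_topologicalClosure _ hy⟩ ∈ S := by
    intro y hy
    induction hy using NonUnitalStarAlgebra.adjoin_induction with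
    | mem x hx =>
      rcases hx with ⟨ξ, rfl⟩ | ⟨a, rfl⟩
      · exact hE ξ
      · exact hA a
    | add x y hx hy h1 h2 => exact (map_add f ⟨x, _⟩ ⟨y, _⟩).symm ▸ add_mem h1 h2
    | zero => exact (map_zero f).symm ▸ zero_mem S
    | mul x y hx hy h1 h2 => exact (map_mul f ⟨x, _⟩ ⟨y, _⟩).symm ▸ mul_mem h1 h2
    | smul r x hx h => exact (map_smul f r ⟨x, _⟩).symm ▸ SMulMemClass.smul_mem r h
    | star x hx h => exact (map_star f ⟨x, _⟩).symm ▸ star_mem h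
  have hcl : (⟨z, hz⟩ : O φ) ∈ closure (Subtype.val ⁻¹' (NonUnitalStarAlgebra.adjoin ℂ
      (Set.range (sumE φ) ∪ Set.range (sumA φ)) : Set (BoundedFamilies φ))) := by
    rw [closure_subtype]
    refine closure_mono (s := (NonUnitalStarAlgebra.adjoin ℂ (Set.range (sumE φ) ∪
      Set.range (sumA φ)) : Set (BoundedFamilies φ))) ?_ hz
    exact fun y hy => ⟨⟨y, NonUnitalStarSubalgebra.le_topologicalClosure _ hy⟩, hy, rfl⟩
  exact (closure_minimal (t := f ⁻¹' S) (fun y hy => hle y.1 hy)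
    (hS.preimage (continuous_starHom f))) hcl

theorem O_hom_ext {D : Type w} [NonUnitalCStarAlgebra D] {f g : O φ →⋆ₙₐ[ℂ] D}
    (hE : ∀ ξ, f ((universalRep φ).toE ξ) = g ((universalRep φ).toE ξ))
    (hA : ∀ a, f ((universalRep φ).toA a) = g ((universalRep φ).toA a)) : f = g := by
  ext z
  have hc : IsClosed ((NonUnitalStarAlgHom.equalizer f g : NonUnitalStarSubalgebra ℂ (O φ)) :
      Set (O φ)) := isClosed_eq (continuous_starHom f) (continuous_starHom g)
  exact O_induction (NonUnitalStarAlgHom.id ℂ (O φ)) _ hc hE hA z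

/-- On a finite sum of operators `θ_{ξ,η}` the value of `ρ⁺` follows from linearity, with no limit
to take. For the modules used below every left multiplication is such a sum. -/
theorem Representation.plus_sum_theta {D : Type w} [NonUnitalCStarAlgebra D]
    (ρ : Representation φ D) {ι : Type*} [Fintype ι] {ξ η : ι → E} {T : E →L[ℂ] E}
    (hT : T ∈ compacts A E) (h : T = ∑ e, theta A (ξ e) (η e)) :
    ρ.plus ⟨T, hT⟩ = ∑ e, ρ.toE (ξ e) * star (ρ.toE (η e)) := by
  have : (⟨T, hT⟩ : compacts A E) = ∑ e, ⟨theta A (ξ e) (η e), theta_mem _ _⟩ :=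
    Subtype.ext (by rw [Submodule.coe_sum]; exact h)
  rw [this, map_sum]
  exact Finset.sum_congr rfl fun e _ => ρ.plus_theta _ _

variable {A : Type} {E : Type} [NonUnitalCommCStarAlgebra A] [PartialOrder A]
  [StarOrderedRing A] [NormedAddCommGroup E] [NormedSpace ℂ E] [CompleteSpace E] [SMul A E]
  [CStarModule A E]
  {B : Type} {F : Type} [NonUnitalCommCStarAlgebra B] [PartialOrder B]
  [StarOrderedRing B] [NormedAddCommGroup F] [NormedSpace ℂ F] [CompleteSpace F] [SMul B F]
  [CStarModule B F]
  {φ : LeftAction A E} {ψ : LeftAction B F}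

/-- If every covariant representation of `ψ` gives one of `φ` on the same algebra, bounded families
indexed by the representations of `φ` can be restricted to the representations of `ψ`. -/
def pullback (G : ∀ i : AnyCovariantRep ψ, CovariantRep φ i.D) :
    BoundedFamilies φ →⋆ₙₐ[ℂ] BoundedFamilies ψ where
  toFun f := ⟨fun i => f ⟨i.D, G i⟩, memℓp_infty
    ⟨‖f‖, by rintro _ ⟨i, rfl⟩; exact lp.norm_apply_le_norm ENNReal.top_ne_zero f _⟩⟩
  map_add' _ _ := rfl
  map_smul' _ _ := rfl
  map_zero' := rfl
  map_mul' _ _ := rfl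
  map_star' _ := rfl

/-- The homomorphism `𝒪_φ → 𝒪_ψ` induced by a covariant representation `G₀` of `φ` on `𝒪_ψ`, given
as a family of covariant representations. -/
theorem exists_hom (G : ∀ i : AnyCovariantRep ψ, CovariantRep φ i.D) (G₀ : CovariantRep φ (O ψ))
    (hE : ∀ i ξ, evalRep ψ i (G₀.toE ξ) = (G i).toE ξ)
    (hA : ∀ i a, evalRep ψ i (G₀.toA a) = (G i).toA a) :
    ∃ Φ : O φ →⋆ₙₐ[ℂ] O ψ, (∀ ξ, Φ ((universalRep φ).toE ξ) = G₀.toE ξ) ∧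
      ∀ a, Φ ((universalRep φ).toA a) = G₀.toA a := by
  -- The component of `f z` at a representation `i` of `ψ` is the component of `z` at `G i`. Only
  -- algebras in the small universe occur here, whereas `O ψ` itself is too large to carry one of
  -- the representations indexing `O φ`.
  let f : O φ →⋆ₙₐ[ℂ] BoundedFamilies ψ :=
    (pullback G).comp (NonUnitalStarSubalgebraClass.subtype (katsuraAlgebra φ))
  have hfE : ∀ ξ, f ((universalRep φ).toE ξ) = G₀.toE ξ :=
    fun ξ => lp.ext (funext fun i => (hE i ξ).symm)
  have hfA : ∀ a, f ((universalRep φ).toA a) = G₀.toA a :=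
    fun a => lp.ext (funext fun i => (hA i a).symm)
  have hf : ∀ z, f z ∈ katsuraAlgebra ψ :=
    O_induction f (katsuraAlgebra ψ) inferInstance (fun ξ => hfE ξ ▸ (G₀.toE ξ).2)
      fun a => hfA a ▸ (G₀.toA a).2
  exact ⟨NonUnitalStarAlgHom.codRestrict f (katsuraAlgebra ψ) hf, fun ξ => Subtype.ext (hfE ξ),
    fun a => Subtype.ext (hfA a)⟩

theorem O_hom_eq_self (f : O φ →⋆ₙₐ[ℂ] O φ)
    (hE : ∀ ξ, f ((universalRep φ).toE ξ) = (universalRep φ).toE ξ)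
    (hA : ∀ a, f ((universalRep φ).toA a) = (universalRep φ).toA a) (z : O φ) : f z = z :=
  DFunLike.congr_fun (O_hom_ext (g := NonUnitalStarAlgHom.id ℂ (O φ)) hE hA) z

theorem evalRep_toE (i : AnyCovariantRep φ) (ξ : E) :
    evalRep φ i ((universalRep φ).toE ξ) = i.rep.toE ξ := rfl

theorem evalRep_toA (i : AnyCovariantRep φ) (a : A) :
    evalRep φ i ((universalRep φ).toA a) = i.rep.toA a := rfl

end Functoriality

-- Norm convergent sums of orthogonal projections.

section OrthogonalProjections

variable {D : Type w} [NonUnitalCStarAlgebra D] {τ : Type u} {e : τ → D}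

/-- Orthogonality makes `c ↦ ∑ c_t e_t` a `⋆`-homomorphism on `ℂ^T` with the supremum norm, and
`⋆`-homomorphisms of `C⋆`-algebras are contractive. -/
theorem norm_sum_smul_le (hs : ∀ t, star (e t) = e t) (he : ∀ t, e t * e t = e t)
    (ho : ∀ t t', t ≠ t' → e t * e t' = 0) (T : Finset τ) (c : τ → ℂ) {C : ℝ} (hC : 0 ≤ C)
    (hc : ∀ t ∈ T, ‖c t‖ ≤ C) : ‖∑ t ∈ T, c t • e t‖ ≤ C := by
  classical
  let f : (T → ℂ) →⋆ₙₐ[ℂ] D :=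
    { toFun := fun c => ∑ t, c t • e t
      map_add' := fun c c' => by simp [add_smul, Finset.sum_add_distrib]
      map_smul' := fun z c => by simp [mul_smul, Finset.smul_sum]
      map_zero' := by simp
      map_mul' := fun c c' => by
        rw [Finset.sum_mul]
        refine Finset.sum_congr rfl fun t _ => ?_
        rw [Finset.mul_sum, Finset.sum_eq_single t]
        · rw [smul_mul_smul_comm, he, Pi.mul_apply]
        · intro t' _ h
          rw [smul_mul_smul_comm, ho _ _ (fun h' => h (Subtype.ext h'.symm)), smul_zero]
        · simp
      map_star' := fun c => by simp [star_sum, hs] }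
  have h := NonUnitalStarAlgHom.norm_apply_le f fun t : T => c t
  have h2 : f (fun t : T => c t) = ∑ t ∈ T, c t • e t := Finset.sum_coe_sort T fun t => c t • e t
  rw [← h2]
  exact h.trans ((pi_norm_le_iff_of_nonneg hC).2 fun t => hc t t.2)

theorem summable_smul_projections (hs : ∀ t, star (e t) = e t) (he : ∀ t, e t * e t = e t)
    (ho : ∀ t t', t ≠ t' → e t * e t' = 0) {c : τ → ℂ} (hc : Tendsto c cofinite (𝓝 0)) :
    Summable fun t => c t • e t := by
  rw [summable_iff_vanishing_norm]
  intro ε hε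
  have h := (Metric.tendsto_nhds.1 hc) (ε / 2) (half_pos hε)
  rw [eventually_cofinite] at h
  -- The finite set to avoid consists of the `t` with `‖c t‖ ≥ ε / 2`; away from it finite sums have
  -- norm at most `ε / 2`.
  refine ⟨h.toFinset, fun T hT => ?_⟩
  refine (norm_sum_smul_le hs he ho T c (half_pos hε).le fun t ht => ?_).trans_lt (half_lt_self hε)
  have := Finset.disjoint_left.1 hT ht
  simp only [Set.Finite.mem_toFinset, Set.mem_ofPred_eq, not_not, dist_zero_right] at this
  exact this.le

variable {B : Type v} [NonUnitalCStarAlgebra B]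

/-- The homomorphism `b ↦ χ∞(b) q + ∑ (χ_t(b) - χ∞(b)) e_t` attached to orthogonal projections
`e_t ≤ q` and to characters `χ_t` converging to `χ∞`. -/
def projectionHom (hs : ∀ t, star (e t) = e t) (he : ∀ t, e t * e t = e t)
    (ho : ∀ t t', t ≠ t' → e t * e t' = 0) {q : D} (hq : q * q = q) (hqs : star q = q)
    (hqe : ∀ t, q * e t = e t) (χ : τ → B →⋆ₙₐ[ℂ] ℂ) (χ' : B →⋆ₙₐ[ℂ] ℂ)
    (hχ : ∀ b, Tendsto (fun t => χ t b) cofinite (𝓝 (χ' b))) : B →⋆ₙₐ[ℂ] D :=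
  have hsum : ∀ b, HasSum (fun t => (χ t b - χ' b) • e t) (∑' t, (χ t b - χ' b) • e t) := fun b =>
    (summable_smul_projections hs he ho (by simpa using (hχ b).sub_const (χ' b))).hasSum
  have heq : ∀ t, e t * q = e t := fun t => by
    rw [← hs t, ← hqs, ← star_mul, hqe]
  { toFun := fun b => χ' b • q + ∑' t, (χ t b - χ' b) • e t
    map_add' := fun a b => by
      have := (tsum_congr fun t => by
        rw [← add_smul, map_add, map_add]; congr 1; ring :
          ∑' t, (χ t (a + b) - χ' (a + b)) • e t = _).trans ((hsum a).add (hsum b)).tsum_eq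
      rw [this, map_add, add_smul]; abel
    map_smul' := fun c a => by
      have := (tsum_congr fun t => by
        rw [smul_smul, map_smul, map_smul]; congr 1; simp only [smul_eq_mul]; ring :
          ∑' t, (χ t (c • a) - χ' (c • a)) • e t = _).trans ((hsum a).const_smul c).tsum_eq
      rw [this, map_smul, smul_assoc, ← smul_add]; rfl
    map_zero' := by simp
    map_mul' := fun a b => by
      have hq' : q * ∑' t, (χ t b - χ' b) • e t = ∑' t, (χ t b - χ' b) • e t := by
        refine ((hsum b).mul_left q).unique ?_
        convert hsum b using 2 with t
        rw [mul_smul_comm, hqe]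
      have hq'' : (∑' t, (χ t a - χ' a) • e t) * q = ∑' t, (χ t a - χ' a) • e t := by
        refine ((hsum a).mul_right q).unique ?_
        convert hsum a using 2 with t
        rw [smul_mul_assoc, heq]
      have het : ∀ t, e t * ∑' t, (χ t b - χ' b) • e t = (χ t b - χ' b) • e t := fun t => by
        refine ((hsum b).mul_left (e t)).unique ?_
        convert hasSum_single t ?_ using 1
        · rw [mul_smul_comm, he]
        · intro t' h
          rw [mul_smul_comm, ho _ _ h.symm, smul_zero]
      have hmul : HasSum (fun t => ((χ t a - χ' a) * (χ t b - χ' b)) • e t)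
          ((∑' t, (χ t a - χ' a) • e t) * ∑' t, (χ t b - χ' b) • e t) := by
        convert (hsum a).mul_right (∑' t, (χ t b - χ' b) • e t) using 2 with t
        rw [smul_mul_assoc, het, smul_smul]
      -- The coefficient of `e_t` is expanded by `χ_t(a) = χ'(a) + (χ_t(a) - χ'(a))` and likewise
      -- for `b`. Its three parts match the two products of a multiple of `q` with a series and the
      -- product of the two series.
      have := (tsum_congr fun t => by
        rw [smul_smul, smul_smul, ← add_smul, ← add_smul, map_mul, map_mul]; congr 1; ring :
          ∑' t, (χ t (a * b) - χ' (a * b)) • e t = _).trans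
        (((hsum a).const_smul (χ' b)).add ((hsum b).const_smul (χ' a)) |>.add hmul).tsum_eq
      rw [this, map_mul, add_mul, mul_add, mul_add, smul_mul_smul_comm, hq,
        smul_mul_assoc, hq', mul_smul_comm, hq'']
      abel
    map_star' := fun a => by
      have := (tsum_congr fun t => by
        rw [star_smul, hs, star_sub, map_star, map_star] :
          ∑' t, (χ t (star a) - χ' (star a)) • e t = _).trans (hsum a).star.tsum_eq
      rw [this, map_star, star_add, star_smul, hqs] }

end OrthogonalProjections

-- Orthogonality of the projections `s^j p (s⋆)^j`.

section ProjectionTower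

variable {D : Type w} [NonUnitalCStarAlgebra D]

/-- The elements `s^j p (s⋆)^j`. -/
def tower (s p : D) : ℕ → D
  | 0 => p
  | j + 1 => s * tower s p j * star s

variable {s p : D}

theorem star_tower (hp : star p = p) (j : ℕ) : star (tower s p j) = tower s p j := by
  induction j with
  | zero => exact hp
  | succ j ih => rw [tower, star_mul, star_mul, star_star, ih, mul_assoc]

theorem mul_tower_zero_left {r : D} (hr : r * s = 0) (j : ℕ) : r * tower s p (j + 1) = 0 := by
  rw [tower, ← mul_assoc, ← mul_assoc, hr, zero_mul, zero_mul]

theorem mul_tower_of_mul {r : D} (hr : r * s = s) (j : ℕ) :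
    r * tower s p (j + 1) = tower s p (j + 1) := by
  rw [tower, ← mul_assoc, ← mul_assoc, hr]

/-- For two positive indices the factor `s⋆s` in the middle is absorbed by the neighbouring stage,
and both indices drop by one. If exactly one index reaches zero, the product vanishes by `p s = 0`
or its adjoint. -/
theorem tower_mul_tower (hp : star p = p) (hpp : p * p = p) (hps : p * s = 0)
    (hsp : star s * s * p = p) (hss : star s * s * s = s) (j k : ℕ) :
    tower s p j * tower s p k = if j = k then tower s p j else 0 := by
  have hq : ∀ k, star s * s * tower s p k = tower s p k
    | 0 => hsp
    | k + 1 => mul_tower_of_mul hss k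
  induction j generalizing k with
  | zero =>
    cases k with
    | zero => simpa [tower] using hpp
    | succ k => simpa [tower] using mul_tower_zero_left hps k
  | succ j ih =>
    cases k with
    | zero =>
      have := congrArg star (mul_tower_zero_left (p := p) hps j)
      rw [star_mul, star_tower hp, hp, star_zero] at this
      simpa [tower] using this
    | succ k =>
      have : tower s p (j + 1) * tower s p (k + 1) =
          s * (tower s p j * (star s * s * tower s p k)) * star s := by
        simp only [tower, mul_assoc]
      rw [this, hq, ih]
      split_ifs <;> simp_all [tower]

end ProjectionTower

-- Covariant representations of the modules `⨁ e, p e B`.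

section DiagonalRepresentation

variable {B ι : Type} [CommCStarAlgebra B] [PartialOrder B] [StarOrderedRing B] [Fintype ι]
  {p : ι → B} {l : ι → B →⋆ₐ[ℂ] B} {D : Type w} [NonUnitalCStarAlgebra D]

open QuantumDisc WithCStarModule

/-- The representation of the correspondence `⨁ e, p e B` determined by a representation of the
coefficients and the images `g e` of the generators. -/
def diagRepresentation (ρ : B →⋆ₙₐ[ℂ] D) (g : ι → D) (hp : ∀ e, p e * p e = p e)
    (hg : ∀ e, star (g e) * g e = ρ (p e)) (hg' : ∀ e f, e ≠ f → star (g e) * g f = 0)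
    (hl : ∀ b e, ρ b * g e = g e * ρ (l e b * p e)) : Representation (diagAction p l) D where
  toE :=
    { toFun := fun ξ => ∑ e, g e * ρ ((ξ : C⋆ᵐᵒᵈ(B, ι → B)) e)
      map_add' := fun ξ η => by simp [mul_add, Finset.sum_add_distrib]
      map_smul' := fun c ξ => by simp [Finset.smul_sum, mul_smul_comm] }
  toA := ρ
  inner_eq ξ η := by
    rw [diag_inner, map_sum]
    change star (∑ e, _) * (∑ e, _) = _
    rw [star_sum, Finset.sum_mul]
    refine Finset.sum_congr rfl fun e _ => ?_
    rw [Finset.mul_sum, Finset.sum_eq_single e]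
    · rw [star_mul, mul_assoc, ← mul_assoc (star (g e)), hg, ← map_star, ← map_mul, ← map_mul,
        η.2 e]
    · intro f _ h
      rw [star_mul, mul_assoc, ← mul_assoc (star (g e)), hg' _ _ h.symm, zero_mul, mul_zero]
    · simp
  left_eq b ξ := by
    change ∑ e, g e * ρ (l e b * _) = ρ b * ∑ e, _
    rw [Finset.mul_sum]
    refine Finset.sum_congr rfl fun e _ => ?_
    rw [← mul_assoc, hl, mul_assoc, ← map_mul, mul_assoc, ξ.2 e]

/-- The generator of the summand `p e B`. -/
abbrev single (hp : ∀ e, p e * p e = p e) (e : ι) : DiagModule p := gen hp (· = e)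

theorem eq_sum_single (hp : ∀ e, p e * p e = p e) (ξ : DiagModule p) :
    ξ = ∑ e, (ξ : C⋆ᵐᵒᵈ(B, ι → B)) e • single hp e := diag_ext fun f => by
  classical
  have hcoe : ((∑ e, (ξ : C⋆ᵐᵒᵈ(B, ι → B)) e • single hp e : DiagModule p) :
      C⋆ᵐᵒᵈ(B, ι → B)) f = ∑ e, (ξ : C⋆ᵐᵒᵈ(B, ι → B)) e *
        (single hp e : C⋆ᵐᵒᵈ(B, ι → B)) f := by
    simp only [Submodule.coe_sum, coe_op_smul]
    exact map_sum (⟨⟨fun ζ : C⋆ᵐᵒᵈ(B, ι → B) => ζ f, rfl⟩, fun _ _ => rfl⟩ :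
      C⋆ᵐᵒᵈ(B, ι → B) →+ B) _ _
  rw [hcoe, Finset.sum_eq_single f]
  · rw [gen_apply, if_pos rfl, mul_comm, ξ.2 f]
  · intro e _ h
    rw [gen_apply, if_neg h.symm, mul_zero]
  · simp

theorem inner_single (hp : ∀ e, p e * p e = p e) (e : ι) (hps : star (p e) = p e)
    (ξ : DiagModule p) :
    inner B (single hp e) ξ = (ξ : C⋆ᵐᵒᵈ(B, ι → B)) e := by
  rw [diag_inner, Finset.sum_eq_single e]
  · rw [gen_apply, if_pos rfl, hps, ξ.2 e]
  · intro f _ h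
    rw [gen_apply, if_neg h, star_zero, zero_mul]
  · simp

/-- The generators `u_e` form a finite Parseval frame: `ξ = ∑ u_e ⟨u_e, ξ⟩`. Applying the left
action, which commutes with the right one, to this expansion gives the sum. -/
theorem diag_toHom_eq (hp : ∀ e, p e * p e = p e) (hps : ∀ e, star (p e) = p e) (b : B) :
    (diagAction p l).toHom b = ∑ e, theta B ((diagAction p l).toHom b (single hp e))
      (single hp e) := by
  ext1 ξ
  rw [sum_apply]
  simp only [theta_apply, inner_single hp _ (hps _)]
  conv_lhs => rw [eq_sum_single hp ξ]
  rw [map_sum]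
  refine Finset.sum_congr rfl fun e _ => diag_ext fun f => ?_
  exact mul_left_comm (l f b) _ _

theorem diag_toHom_mem (hp : ∀ e, p e * p e = p e) (hps : ∀ e, star (p e) = p e) (b : B) :
    (diagAction p l).toHom b ∈ compacts B (DiagModule p) := by
  rw [diag_toHom_eq hp hps]
  exact sum_mem fun e _ => theta_mem _ _

/-- This turns the covariance condition at `b` into `b ∑ g_e g_e⋆ = b`, where the `g_e` are the
images of the generators. -/
theorem diag_plus (hp : ∀ e, p e * p e = p e) (hps : ∀ e, star (p e) = p e)
    (ρ : Representation (diagAction p l) D) (b : B) :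
    ρ.plus ⟨(diagAction p l).toHom b, diag_toHom_mem hp hps b⟩ =
      ρ.toA b * ∑ e, ρ.toE (single hp e) * star (ρ.toE (single hp e)) := by
  rw [ρ.plus_sum_theta _ (diag_toHom_eq hp hps b), Finset.mul_sum]
  refine Finset.sum_congr rfl fun e _ => ?_
  rw [ρ.left_eq, mul_assoc]

theorem diag_toHom_eq_zero_iff (hp : ∀ e, p e * p e = p e) (b : B) :
    (diagAction p l).toHom b = 0 ↔ ∀ e, l e b * p e = 0 := by
  constructor
  · intro h e
    have := congrArg (fun ζ : DiagModule p => (ζ : C⋆ᵐᵒᵈ(B, ι → B)) e)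
      (congrArg (fun T : DiagModule p →L[ℂ] DiagModule p => T (single hp e)) h)
    change l e b * _ = 0 at this
    rwa [gen_apply, if_pos rfl] at this
  · intro h
    ext1 ξ
    refine diag_ext fun e => ?_
    change l e b * _ = 0
    rw [← ξ.2 e, ← mul_assoc, h, zero_mul]

/-- Left multiplications are always compact here, so only the annihilator condition remains. -/
theorem mem_katsuraIdeal_diag (hp : ∀ e, p e * p e = p e) (hps : ∀ e, star (p e) = p e) (b : B) :
    b ∈ katsuraIdeal (diagAction p l) ↔ ∀ c, (∀ e, l e c * p e = 0) → b * c = 0 := by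
  simp only [katsuraIdeal, Set.mem_ofPred_eq, diag_toHom_eq_zero_iff hp]
  exact and_iff_right (diag_toHom_mem hp hps b)

theorem diagRepresentation_single (hp : ∀ e, p e * p e = p e) (ρ : B →⋆ₙₐ[ℂ] D) (g : ι → D)
    (hg : ∀ e, star (g e) * g e = ρ (p e)) (hg' : ∀ e f, e ≠ f → star (g e) * g f = 0)
    (hl : ∀ b e, ρ b * g e = g e * ρ (l e b * p e)) (e : ι) :
    (diagRepresentation ρ g hp hg hg' hl).toE (single hp e) = g e := by
  -- The element `g_e` has source projection `ρ(p_e)`: the difference `d = g_e ρ(p_e) - g_e`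
  -- satisfies `d⋆d = 0`.
  have habs : g e * ρ (p e) = g e := by
    rw [← sub_eq_zero, ← CStarRing.star_mul_self_eq_zero_iff]
    have h1 : star (ρ (p e)) = ρ (p e) := by rw [← hg, star_mul, star_star]
    have h2 : ρ (p e) * ρ (p e) = ρ (p e) := by rw [← map_mul, hp]
    rw [star_sub, star_mul, h1, sub_mul, mul_sub, mul_sub, ← mul_assoc (star (g e)), hg,
      mul_assoc, mul_assoc, ← mul_assoc (star (g e)), hg, h2, h2, sub_self]
  change ∑ f, g f * ρ _ = g e
  rw [Finset.sum_eq_single e]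
  · rw [gen_apply, if_pos rfl, habs]
  · intro f _ h
    rw [gen_apply, if_neg h, map_zero, mul_zero]
  · simp

/-- A representation of `⨁ e, p e B` determined by the images of the generators, if covariant. -/
def diagCovariantRep (hp : ∀ e, p e * p e = p e) (ρ : B →⋆ₙₐ[ℂ] D) (g : ι → D)
    (hps : ∀ e, star (p e) = p e)
    (hg : ∀ e, star (g e) * g e = ρ (p e)) (hg' : ∀ e f, e ≠ f → star (g e) * g f = 0)
    (hl : ∀ b e, ρ b * g e = g e * ρ (l e b * p e))
    (hc : ∀ b, (∀ c, (∀ e, l e c * p e = 0) → b * c = 0) →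
      ρ b * ∑ e, g e * star (g e) = ρ b) : CovariantRep (diagAction p l) D where
  toRepresentation := diagRepresentation ρ g hp hg hg' hl
  covariant b hb := by
    rw [diag_plus hp hps]
    simp only [diagRepresentation_single]
    exact hc b ((mem_katsuraIdeal_diag hp hps b).1 hb)

theorem CovariantRep.diag_covariant (hp : ∀ e, p e * p e = p e) (hps : ∀ e, star (p e) = p e)
    (ρ : CovariantRep (diagAction p l) D) {b : B}
    (hb : ∀ c, (∀ e, l e c * p e = 0) → b * c = 0) :
    ρ.toA b * ∑ e, ρ.toE (single hp e) * star (ρ.toE (single hp e)) = ρ.toA b := by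
  rw [← diag_plus hp hps]
  exact ρ.covariant b ((mem_katsuraIdeal_diag hp hps b).2 hb)

theorem Representation.toE_eq_sum (hp : ∀ e, p e * p e = p e)
    (ρ : Representation (diagAction p l) D) (ξ : DiagModule p) :
    ρ.toE ξ = ∑ e, ρ.toE (single hp e) * ρ.toA ((ξ : C⋆ᵐᵒᵈ(B, ι → B)) e) := by
  conv_lhs => rw [eq_sum_single hp ξ, map_sum]
  exact Finset.sum_congr rfl fun e _ => ρ.toE_op_smul _ _

/-- A homomorphism intertwines two representations as soon as it does so on generators. -/
theorem Representation.map_toE_of_single (hp : ∀ e, p e * p e = p e) {D' : Type v}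
    [NonUnitalCStarAlgebra D'] (ρ : Representation (diagAction p l) D)
    (ρ' : Representation (diagAction p l) D') (f : D →⋆ₙₐ[ℂ] D')
    (hg : ∀ e, f (ρ.toE (single hp e)) = ρ'.toE (single hp e))
    (hA : ∀ b, f (ρ.toA b) = ρ'.toA b) (ξ : DiagModule p) : f (ρ.toE ξ) = ρ'.toE ξ := by
  rw [ρ.toE_eq_sum hp ξ, ρ'.toE_eq_sum hp ξ, map_sum]
  refine Finset.sum_congr rfl fun e _ => ?_
  rw [map_mul, hg, hA]

end DiagonalRepresentation

end CStarCorr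

namespace CStarCorr

/-- The right action is only required to be compatible with the inner product, so the unit law is
read off from inner products. -/
theorem one_op_smul {B ι : Type} [CommCStarAlgebra B] [PartialOrder B] [StarOrderedRing B]
    [Fintype ι] {p : ι → B} (ξ : DiagModule p) : (1 : B) • ξ = ξ :=
  ext_inner B fun ζ => by rw [CStarModule.inner_op_smul_right, one_mul]

theorem zero_op_smul {B ι : Type} [CommCStarAlgebra B] [PartialOrder B] [StarOrderedRing B]
    [Fintype ι] {p : ι → B} (ξ : DiagModule p) : (0 : B) • ξ = 0 :=
  ext_inner B fun ζ => by
    rw [CStarModule.inner_op_smul_right, zero_mul, CStarModule.inner_zero_right]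

namespace QuantumDisc

universe w

open Filter Topology OnePoint

variable {n : ℕ}

-- Sums over edges and vertices of the graph.

section Combinatorics

/-- The predicate `p` restricts the source vertex: `· ≤ n` gives the edges of `X`, and `· < n` the
generators `x_{i,j}` of `Y`. -/
theorem sum_edges {M : Type*} [AddCommMonoid M] (p : ℕ → Prop) [DecidablePred p]
    (f : ℕ → ℕ → M) :
    ∑ e : {e : V n × V n // p e.1 ∧ (e.1 : ℕ) ≤ e.2}, f e.1.1 e.1.2 =
      ∑ i ∈ (Finset.Icc 1 (n + 1)).filter p, ∑ j ∈ Finset.Icc i (n + 1), f i j := by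
  rw [Finset.sum_sigma']
  refine Finset.sum_bij (fun e _ => ⟨e.1.1, e.1.2⟩) ?_ ?_ ?_ fun _ _ => rfl
  · rintro ⟨⟨⟨i, hi⟩, ⟨j, hj⟩⟩, hp, hij⟩ -
    simp only [Finset.mem_Icc] at hi hj
    simp only [Finset.mem_sigma, Finset.mem_filter, Finset.mem_Icc]
    exact ⟨⟨hi, hp⟩, hij, hj.2⟩
  · rintro ⟨⟨⟨i, hi⟩, ⟨j, hj⟩⟩, h⟩ - ⟨⟨⟨i', hi'⟩, ⟨j', hj'⟩⟩, h'⟩ - heq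
    simp only [Sigma.mk.injEq, heq_eq_eq] at heq
    obtain ⟨rfl, rfl⟩ := heq
    rfl
  · rintro ⟨i, j⟩ h
    simp only [Finset.mem_sigma, Finset.mem_filter, Finset.mem_Icc] at h
    exact ⟨⟨(⟨i, by simp; omega⟩, ⟨j, by simp; omega⟩), h.1.2, h.2.1⟩, Finset.mem_univ _, rfl⟩

theorem Icc_succ_eq : Finset.Icc n (n + 1) = {n, n + 1} := by
  ext i; simp; omega

theorem sum_Icc_eq {M : Type*} [AddCommMonoid M] (f : ℕ → M) :
    ∑ i ∈ Finset.Icc 1 (n + 1), f i =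
      f (n + 1) + ∑ i ∈ (Finset.Icc 1 (n + 1)).filter (· ≤ n), f i := by
  rw [← Finset.sum_insert (by simp)]
  congr 1
  ext i; simp; omega

theorem sum_filter_le_eq {M : Type*} [AddCommMonoid M] (hn : 1 ≤ n) (f : ℕ → M) :
    ∑ i ∈ (Finset.Icc 1 (n + 1)).filter (· ≤ n), f i =
      f n + ∑ i ∈ (Finset.Icc 1 (n + 1)).filter (· < n), f i := by
  rw [← Finset.sum_insert (by simp)]
  congr 1
  ext i; simp; omega

end Combinatorics

-- Generators of the coefficient algebras and modules.

section Generators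

theorem star_P (i : ℕ) : star (P n i) = P n i := by
  ext v; simp [P]

theorem P_mul_P (i j : ℕ) : P n i * P n j = if i = j then P n i else 0 := by
  ext v; by_cases h : i = j <;> simp [P, h]; grind

theorem star_projX (e : EdgeX n) : star (projX n e) = projX n e := star_P _

theorem star_projY (e : EdgeY n) : star (projY n e) = projY n e := by
  rcases e with _ | e <;> exact star_R _

theorem star_Q (j : ℕ+) : star (Q n j) = Q n j := by
  ext (v | t)
  · simp [Q]
  · induction t using OnePoint.rec <;> simp [Q]

theorem w_eq_single (e : EdgeX n) : w n e.1.1 e.1.2 = single (projX_mul_self n) e := by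
  obtain ⟨⟨⟨i, hi⟩, ⟨j, hj⟩⟩, h⟩ := e
  unfold w single
  congr 1
  ext ⟨⟨⟨i', hi'⟩, ⟨j', hj'⟩⟩, h'⟩
  simp

theorem x_eq_single (e : {e : V n × V n // (e.1 : ℕ) < n ∧ (e.1 : ℕ) ≤ e.2}) :
    x n e.1.1 e.1.2 = single (projY_mul_self n) (Option.some e) := by
  obtain ⟨⟨⟨i, hi⟩, ⟨j, hj⟩⟩, h⟩ := e
  unfold x single
  congr 1
  ext (_ | ⟨⟨⟨i', hi'⟩, ⟨j', hj'⟩⟩, h'⟩)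
  · simp
  · simp

theorem y_eq_single : y n = single (projY_mul_self n) none := rfl

theorem sum_P : ∑ i ∈ Finset.Icc 1 (n + 1), P n i = 1 := by
  ext v
  have := v.2
  rw [Finset.sum_apply]
  simp only [P, Finset.sum_ite_eq, Pi.one_apply, ite_eq_left_iff]
  exact fun h => absurd this h

theorem sum_R (hn : 1 ≤ n) : ∑ i ∈ Finset.Icc 1 (n + 1), R n i = 1 := by
  ext (v | t)
  · have := v.1.2
    rw [ContinuousMap.sum_apply]
    simp only [R, ContinuousMap.coe_mk, Sum.elim_inl, Finset.sum_ite_eq, ContinuousMap.one_apply,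
      ite_eq_left_iff]
    exact fun h => absurd this h
  · rw [ContinuousMap.sum_apply]
    simp [R, hn]

theorem A_induction (S : Submodule ℂ (A n)) (h : ∀ i, 1 ≤ i → i ≤ n + 1 → P n i ∈ S) (a : A n) :
    a ∈ S := by
  have : a = ∑ v, a v • P n v := by
    ext v
    rw [Finset.sum_apply, Finset.sum_eq_single v]
    · simp [P]
    · intro v' _ h
      have : (v : ℕ) ≠ v' := fun h' => h (Subtype.ext h'.symm)
      simp [P, this]
    · simp
  rw [this]
  refine sum_mem fun v _ => S.smul_mem _ (h v ?_ ?_)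
  · exact (Finset.mem_Icc.1 v.2).1
  · exact (Finset.mem_Icc.1 v.2).2

/-- The isolated points of `K`. -/
def isolated (n : ℕ) : {v : V n // (v : ℕ) ≠ n} ⊕ ℕ+ → K n := Sum.map id (↑)

theorem tendsto_isolated : Tendsto (isolated n) cofinite (𝓝 (Sum.inr ∞)) := by
  have h : Tendsto (fun k : ℕ+ => (Sum.inr (k : OnePoint ℕ+) : K n)) cofinite (𝓝 (Sum.inr ∞)) :=
    (continuous_inr.tendsto _).comp ((continuous_iff_from_discrete id).1 continuous_id)
  intro U hU
  have hfin := mem_cofinite.1 (mem_map.1 (h hU))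
  rw [mem_map, mem_cofinite]
  -- There are finitely many isolated points of the first kind, so only the points of the `Q_k`
  -- matter for the limit.
  refine ((Set.finite_range Sum.inl).union (hfin.image Sum.inr)).subset ?_
  rintro (v | k) hk
  · exact Or.inl ⟨v, rfl⟩
  · exact Or.inr ⟨k, hk, rfl⟩

theorem tendsto_apply_isolated (b : B n) :
    Tendsto (fun t => b (isolated n t)) cofinite (𝓝 (b (Sum.inr ∞))) :=
  (b.continuous.tendsto _).comp tendsto_isolated

/-- Every `b` is the norm limit of the partial sums of `b(∞) 1 + ∑ (b(t) - b(∞)) e_t`, where the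
`e_t` are the `R_i` with `i ≠ n` and the `Q_j`. The unit is the sum of all `R_i`. -/
theorem B_induction (hn : 1 ≤ n) (S : Submodule ℂ (B n)) (hS : IsClosed (S : Set (B n)))
    (hR : ∀ i, 1 ≤ i → i ≤ n + 1 → R n i ∈ S) (hQ : ∀ j, Q n j ∈ S) (b : B n) : b ∈ S := by
  let e : {v : V n // (v : ℕ) ≠ n} ⊕ ℕ+ → B n := Sum.elim (fun v => R n v.1) (Q n)
  have hsum : Summable fun t => (b (isolated n t) - b (Sum.inr ∞)) • e t := by
    refine summable_smul_projections (e := e) ?_ ?_ ?_ ?_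
    · rintro (v | j)
      · exact star_R _
      · exact star_Q _
    · rintro (v | j)
      · exact R_mul_self _ _
      · exact (Q_mul_Q).trans (if_pos rfl)
    · rintro (v | j) (v' | j') h
      · exact R_mul_R.trans (if_neg fun h' => h (congrArg _ (Subtype.ext (Subtype.ext h'))))
      · exact (mul_comm _ _).trans (Q_mul_R.trans (if_neg v.2))
      · exact Q_mul_R.trans (if_neg v'.2)
      · exact Q_mul_Q.trans (if_neg fun h' => h (congrArg _ h'))
    · simpa using (tendsto_apply_isolated b).sub_const (b (Sum.inr ∞))
  have key : b = b (Sum.inr ∞) • (1 : B n) +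
      ∑' t, (b (isolated n t) - b (Sum.inr ∞)) • e t := by
    ext k
    have hk := hsum.hasSum.map (ContinuousMap.evalCLM ℂ k) (ContinuousMap.evalCLM ℂ k).continuous
    have hk' : HasSum (fun t => (b (isolated n t) - b (Sum.inr ∞)) * e t k)
      ((∑' t, (b (isolated n t) - b (Sum.inr ∞)) • e t : B n) k) := hk
    -- Evaluation at `k` is continuous, hence may be carried out termwise; at an isolated point a
    -- single projection is nonzero.
    have hpt : ∀ t, isolated n t = k → (∀ t', t' ≠ t → e t' k = 0) → e t k = 1 →
        (∑' t, (b (isolated n t) - b (Sum.inr ∞)) • e t : B n) k = b k - b (Sum.inr ∞) := by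
      intro t ht h0 h1
      refine hk'.unique ?_
      convert hasSum_single t ?_ using 1
      · rw [h1, ht, mul_one]
      · intro t' h
        rw [h0 t' h, mul_zero]
    rw [ContinuousMap.add_apply, ContinuousMap.smul_apply, ContinuousMap.one_apply, smul_eq_mul,
      mul_one]
    rcases k with v | t
    · rw [hpt (Sum.inl v) rfl, add_sub_cancel]
      · rintro (v' | j) h
        · have : ¬ v.1 = v'.1 := fun h' => h (congrArg _ (Subtype.ext h'.symm))
          simp [e, R, this]
        · simp [e, Q]
      · simp [e, R]
    · induction t using OnePoint.rec with
      | infty =>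
        have : (∑' t, (b (isolated n t) - b (Sum.inr ∞)) • e t : B n) (Sum.inr ∞) = 0 := by
          refine hk'.unique ?_
          convert hasSum_zero using 2 with t
          rcases t with v | j
          · simp [e, R, v.2]
          · simp [e, Q]
        rw [this, add_zero]
      | coe j =>
        rw [hpt (Sum.inr j) rfl, add_sub_cancel]
        · rintro (v' | j') h
          · simp [e, R, v'.2]
          · have : j ≠ j' := fun h' => h (congrArg _ h'.symm)
            simp [e, Q, this]
        · simp [e, Q]
  have he : ∀ t, e t ∈ S := by
    rintro (v | j)
    · exact hR _ (Finset.mem_Icc.1 v.1.2).1 (Finset.mem_Icc.1 v.1.2).2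
    · exact hQ j
  have h1 : (1 : B n) ∈ S := by
    rw [← sum_R hn]
    exact sum_mem fun i hi => hR i (Finset.mem_Icc.1 hi).1 (Finset.mem_Icc.1 hi).2
  rw [key]
  exact S.add_mem (S.smul_mem _ h1)
    (hS.mem_of_tendsto hsum.hasSum (Eventually.of_forall fun T =>
      sum_mem fun t _ => S.smul_mem _ (he t)))

end Generators

-- Relations in a covariant representation of `X`, and the induced representation of `B`.

section RepresentationsOfX

variable {D : Type w} [NonUnitalCStarAlgebra D] (ρ : CovariantRep (actionX n) D)

namespace CovX

/-- The image of `P_i`. -/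
def vertexProj (i : ℕ) : D := ρ.toA (P n i)

/-- The image of `w_{i,j}`. -/
def edge (i j : ℕ) : D := ρ.toE (w n i j)

theorem P_mul_w (i j k : ℕ) :
    vertexProj ρ k * edge ρ i j = if i = k then edge ρ i j else 0 := by
  unfold vertexProj edge
  rw [← ρ.left_eq, left_w]
  split_ifs
  · rw [one_op_smul]
  · rw [zero_op_smul, map_zero]

theorem w_mul_P (i j k : ℕ) :
    edge ρ i j * vertexProj ρ k = if j = k then edge ρ i j else 0 := by
  unfold vertexProj edge
  rw [← ρ.toE_op_smul, P_smul_w]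
  split_ifs
  · rw [one_op_smul]
  · rw [zero_op_smul, map_zero]

theorem star_w_mul_w_self {i j : ℕ} (hi : 1 ≤ i) (hin : i ≤ n) (hij : i ≤ j) (hj : j ≤ n + 1) :
    star (edge ρ i j) * edge ρ i j = vertexProj ρ j := by
  unfold vertexProj edge
  rw [ρ.inner_eq, inner_w_self hi hin hij hj]

theorem star_w_mul_w {i j k l : ℕ} (h : ¬ (i = k ∧ j = l)) :
    star (edge ρ i j) * edge ρ k l = 0 := by
  unfold edge
  rw [ρ.inner_eq, inner_w_of_ne h, map_zero]

theorem star_toA_P (i : ℕ) : star (vertexProj ρ i) = vertexProj ρ i := by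
  unfold vertexProj
  rw [← map_star, star_P]

theorem toA_P_mul_P (i j : ℕ) :
    vertexProj ρ i * vertexProj ρ j = if i = j then vertexProj ρ i else 0 := by
  unfold vertexProj
  rw [← map_mul, P_mul_P]; split_ifs <;> simp

/-- This is the Cuntz–Krieger relation at `v_k`. Covariance applies to `P_k` because of the loop
`w_{k,k}`: an element acting as zero on it has vanishing coordinate at `v_k`, hence is annihilated
by `P_k`. -/
theorem sum_w_mul_star {k : ℕ} (hk : 1 ≤ k) (hkn : k ≤ n) :
    ∑ j ∈ Finset.Icc k (n + 1), edge ρ k j * star (edge ρ k j) = vertexProj ρ k := by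
  have h : vertexProj ρ k * ∑ e : EdgeX n, edge ρ e.1.1 e.1.2 * star (edge ρ e.1.1 e.1.2) =
      vertexProj ρ k := by
    simp only [edge, w_eq_single]
    refine ρ.diag_covariant (projX_mul_self n) star_projX fun c hc => ?_
    have h1 := congrFun (hc ⟨(⟨k, by simp; omega⟩, ⟨k, by simp; omega⟩), hkn, le_rfl⟩)
      ⟨k, by simp; omega⟩
    have h2 : c ⟨k, by simp; omega⟩ * P n k ⟨k, by simp; omega⟩ = 0 := h1
    ext ⟨v, hv'⟩
    by_cases hv : v = k
    · subst hv
      simpa [P] using h2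
    · simp [P, hv]
  rw [sum_edges (· ≤ n) fun i j => edge ρ i j * star (edge ρ i j)] at h
  refine Eq.trans (Eq.symm ?_) h
  rw [Finset.mul_sum, Finset.sum_eq_single k]
  · rw [Finset.mul_sum]
    refine Finset.sum_congr rfl fun j _ => ?_
    rw [← mul_assoc, P_mul_w, if_pos rfl]
  · intro i _ hi
    rw [Finset.mul_sum]
    refine Finset.sum_eq_zero fun j _ => ?_
    rw [← mul_assoc, P_mul_w, if_neg hi, zero_mul]
  · intro h
    simp at h
    omega

/-- The partial isometry `s`. -/
def isom : D := edge ρ n n + edge ρ n (n + 1)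

theorem star_isom_mul_isom (hn : 1 ≤ n) :
    star (isom ρ) * isom ρ = vertexProj ρ n + vertexProj ρ (n + 1) := by
  rw [isom, star_add, add_mul, mul_add, mul_add, star_w_mul_w_self ρ hn le_rfl le_rfl (by omega),
    star_w_mul_w_self ρ hn le_rfl (by omega) le_rfl, star_w_mul_w ρ (by omega),
    star_w_mul_w ρ (by omega), add_zero, zero_add]

theorem w_mul_star_w {i j k l : ℕ} (h : j ≠ l) :
    edge ρ i j * star (edge ρ k l) = 0 := by
  have h1 : edge ρ i j = edge ρ i j * vertexProj ρ j := by rw [w_mul_P, if_pos rfl]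
  have h2 : vertexProj ρ j * star (edge ρ k l) = 0 := by
    rw [← star_toA_P, ← star_mul, w_mul_P, if_neg h.symm, star_zero]
  rw [h1, mul_assoc, h2, mul_zero]

/-- The cross terms vanish because the two edges end at different vertices. The rest is the
Cuntz–Krieger relation at `v_n`, whose only outgoing edges are these two. -/
theorem isom_mul_star_isom (hn : 1 ≤ n) : isom ρ * star (isom ρ) = vertexProj ρ n := by
  rw [← sum_w_mul_star ρ hn le_rfl, Icc_succ_eq, Finset.sum_pair (by omega), isom, star_add,
    add_mul, mul_add, mul_add, w_mul_star_w ρ n.succ_ne_self.symm, w_mul_star_w ρ n.succ_ne_self,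
    add_zero, zero_add]

theorem P_mul_isom (k : ℕ) : vertexProj ρ k * isom ρ = if n = k then isom ρ else 0 := by
  rw [isom, mul_add, P_mul_w, P_mul_w]
  split_ifs <;> simp

/-- The projections `s^j P_{n+1} (s⋆)^j`. -/
abbrev range (j : ℕ) : D := tower (isom ρ) (vertexProj ρ (n + 1)) j

/-- Positivity of `j` matters: the stage `j = 0` is `P_{n+1}`, while later stages begin with `s` and
so lie under `P_n`. -/
theorem P_mul_range (k : ℕ) (j : ℕ+) :
    vertexProj ρ k * range ρ j = if n = k then range ρ j else 0 := by
  obtain ⟨j, rfl⟩ : ∃ m : ℕ, j = m.succPNat := ⟨j.natPred, j.succPNat_natPred.symm⟩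
  split_ifs with h
  · exact mul_tower_of_mul (by rw [P_mul_isom, if_pos h]) j
  · exact mul_tower_zero_left (by rw [P_mul_isom, if_neg h]) j

/-- The range projection `P_n` of `s` lies under its source projection `P_n + P_{n+1}`. -/
theorem isom_hyp (hn : 1 ≤ n) : star (isom ρ) * isom ρ * isom ρ = isom ρ := by
  rw [star_isom_mul_isom ρ hn, add_mul, P_mul_isom, P_mul_isom, if_pos rfl, if_neg (by omega),
    add_zero]

theorem range_mul_range (hn : 1 ≤ n) (j k : ℕ) :
    range ρ j * range ρ k = if j = k then range ρ j else 0 := by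
  refine tower_mul_tower (star_toA_P ρ _) ?_ ?_ ?_ (isom_hyp ρ hn) j k
  · rw [toA_P_mul_P, if_pos rfl]
  · rw [P_mul_isom, if_neg (by omega)]
  · rw [star_isom_mul_isom ρ hn, add_mul, toA_P_mul_P, toA_P_mul_P, if_pos rfl,
      if_neg (by omega), zero_add]

/-- The projections which are the images of the `R_i` (`i ≠ n`) and of the `Q_j`. -/
def proj : {v : V n // (v : ℕ) ≠ n} ⊕ ℕ+ → D :=
  Sum.elim (fun v => vertexProj ρ v.1) fun j => range ρ j

theorem star_proj (t) : star (proj ρ t) = proj ρ t := by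
  rcases t with v | j
  · exact star_toA_P ρ _
  · exact star_tower (star_toA_P ρ _) _

theorem proj_mul_proj (hn : 1 ≤ n) (t t') (h : t ≠ t') : proj ρ t * proj ρ t' = 0 := by
  rcases t with v | j <;> rcases t' with v' | j'
  · exact (toA_P_mul_P ρ _ _).trans
      (if_neg fun h' => h (congrArg _ (Subtype.ext (Subtype.ext h'))))
  · exact (P_mul_range ρ _ _).trans (if_neg v.2.symm)
  · rw [← star_proj, ← star_proj ρ (Sum.inl v'), ← star_mul, ← star_zero]
    exact congrArg _ ((P_mul_range ρ _ _).trans (if_neg v'.2.symm))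
  · exact (range_mul_range ρ hn _ _).trans (if_neg fun h' => h (congrArg _ (PNat.coe_injective h')))

theorem proj_mul_self (hn : 1 ≤ n) (t) : proj ρ t * proj ρ t = proj ρ t := by
  rcases t with v | j
  · exact (toA_P_mul_P ρ _ _).trans (if_pos rfl)
  · exact (range_mul_range ρ hn _ _).trans (if_pos rfl)

theorem one_mul_proj (hn : 1 ≤ n) (t) : ρ.toA 1 * proj ρ t = proj ρ t := by
  rcases t with v | j
  · change ρ.toA 1 * ρ.toA _ = ρ.toA _
    rw [← map_mul, one_mul]
  · change ρ.toA 1 * range ρ j = range ρ j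
    have := P_mul_range ρ n j
    rw [if_pos rfl] at this
    have h1 : ρ.toA 1 * vertexProj ρ n = vertexProj ρ n := by
      unfold vertexProj
      rw [← map_mul, one_mul]
    rw [← this, ← mul_assoc, h1]

/-- The homomorphism `B → D` with `R_i ↦ P_i` and `Q_j ↦ s^j P_{n+1} (s⋆)^j`. -/
def coeffHom (hn : 1 ≤ n) : B n →⋆ₙₐ[ℂ] D :=
  projectionHom (star_proj ρ) (proj_mul_self ρ hn) (proj_mul_proj ρ hn) (q := ρ.toA 1)
    (by rw [← map_mul, one_mul]) (by rw [← map_star, star_one]) (one_mul_proj ρ hn)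
    (fun t => (ContinuousMap.evalStarAlgHom ℂ ℂ (isolated n t) : B n →⋆ₐ[ℂ] ℂ))
    (ContinuousMap.evalStarAlgHom ℂ ℂ (Sum.inr ∞ : K n) : B n →⋆ₐ[ℂ] ℂ) tendsto_apply_isolated

theorem coeffHom_apply (hn : 1 ≤ n) (b : B n) : coeffHom ρ hn b = b (Sum.inr ∞) • ρ.toA 1 +
    ∑' t, (b (isolated n t) - b (Sum.inr ∞)) • proj ρ t := rfl

theorem coeffHom_of_apply (hn : 1 ≤ n) {b : B n} (t) (h : b (Sum.inr ∞) = 0)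
    (h' : ∀ t', b (isolated n t') = if t' = t then 1 else 0) : coeffHom ρ hn b = proj ρ t := by
  rw [coeffHom_apply, h, zero_smul, zero_add, tsum_eq_single t]
  · rw [h', if_pos rfl, sub_zero, one_smul]
  · intro t' ht
    rw [h', if_neg ht, sub_zero, zero_smul]

theorem coeffHom_one (hn : 1 ≤ n) : coeffHom ρ hn 1 = ρ.toA 1 := by
  rw [coeffHom_apply]; simp

theorem coeffHom_Q (hn : 1 ≤ n) (j : ℕ+) : coeffHom ρ hn (Q n j) = range ρ j := by
  refine coeffHom_of_apply ρ hn (Sum.inr j) (by simp [Q]) ?_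
  rintro (v | k)
  · simp [isolated, Q]
  · simp [isolated, Q]

/-- For `i ≠ n` the function `R_i` is supported at one isolated point and the series has one term.
The support of `R_n` contains the limit point, so `R_n` is reached by subtracting the other `R_i`
from the unit, and the other `P_i` from the unit of `A`. -/
theorem coeffHom_R (hn : 1 ≤ n) {i : ℕ} (hi : 1 ≤ i) (hi' : i ≤ n + 1) :
    coeffHom ρ hn (R n i) = vertexProj ρ i := by
  have hne : ∀ k ∈ Finset.Icc 1 (n + 1), k ≠ n → coeffHom ρ hn (R n k) = vertexProj ρ k := by
    intro k hk hkn
    refine coeffHom_of_apply ρ hn (Sum.inl ⟨⟨k, hk⟩, hkn⟩) (by simp [R, hkn]) ?_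
    rintro (v | j)
    · simp [isolated, R, Subtype.ext_iff]
    · simp [isolated, R, hkn]
  by_cases h : i = n
  · subst h
    have hmem : i ∈ Finset.Icc 1 (i + 1) := Finset.mem_Icc.2 ⟨hi, hi'⟩
    have h1 := coeffHom_one ρ hn
    rw [← sum_R hn, ← sum_P, map_sum, map_sum, ← Finset.add_sum_erase _ _ hmem,
      ← Finset.add_sum_erase _ _ hmem, Finset.sum_congr rfl fun k hk =>
        hne k (Finset.mem_of_mem_erase hk) (Finset.ne_of_mem_erase hk)] at h1
    exact add_right_cancel h1
  · exact hne i (Finset.mem_Icc.2 ⟨hi, hi'⟩) h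

end CovX

end RepresentationsOfX

end QuantumDisc

end CStarCorr

namespace CStarCorr

namespace QuantumDisc

universe w

open Filter Topology WithCStarModule
open scoped OnePoint

variable {n : ℕ}

/-- An intertwining relation with a representation of `B` may be checked on the generators. -/
theorem intertwine_of_generators (hn : 1 ≤ n) {D : Type w} [NonUnitalCStarAlgebra D]
    (ρ : B n →⋆ₙₐ[ℂ] D) (g : D) (l : B n →⋆ₐ[ℂ] B n) (p : B n)
    (hR : ∀ i, 1 ≤ i → i ≤ n + 1 → ρ (R n i) * g = g * ρ (l (R n i) * p))
    (hQ : ∀ j, ρ (Q n j) * g = g * ρ (l (Q n j) * p)) (b : B n) :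
    ρ b * g = g * ρ (l b * p) := by
  let S : Submodule ℂ (B n) :=
    { carrier := {b | ρ b * g = g * ρ (l b * p)}
      add_mem' := fun {a b} ha hb => by
        change ρ (a + b) * g = g * ρ (l (a + b) * p)
        rw [map_add, map_add, add_mul, add_mul, map_add, mul_add, ← ha, ← hb]
      zero_mem' := by
        change ρ 0 * g = g * ρ (l 0 * p)
        simp
      smul_mem' := fun c b hb => by
        change ρ (c • b) * g = g * ρ (l (c • b) * p)
        rw [map_smul, map_smul, smul_mul_assoc, smul_mul_assoc, map_smul, mul_smul_comm, ← hb] }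
  have hl : Continuous l := continuous_starHom (l : B n →⋆ₙₐ[ℂ] B n)
  have hρ := continuous_starHom ρ
  refine B_induction hn S
    (isClosed_eq (f := fun b => ρ b * g) (g := fun b => g * ρ (l b * p)) ?_ ?_)
    hR hQ b
  · exact hρ.mul continuous_const
  · exact continuous_const.mul (hρ.comp (hl.mul continuous_const))

/-- The component at `y` of the module identity `left_R_y`, as an identity in `B`. -/
theorem R_comp_shift_mul (k : ℕ) : (R n k).comp (shift n) * R n n =
    ((if n = k then 1 - Q n 1 else 0) + if n + 1 = k then Q n 1 else 0) * R n n := by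
  have h := congrArg (fun ξ : Y n => (ξ : C⋆ᵐᵒᵈ(B n, EdgeY n → B n)) none)
    (left_R_y (n := n) (k := k))
  change (R n k).comp (shift n) * (y n : C⋆ᵐᵒᵈ(B n, EdgeY n → B n)) none =
    _ * (y n : C⋆ᵐᵒᵈ(B n, EdgeY n → B n)) none at h
  rw [y_eq_single, gen_apply, if_pos rfl] at h
  exact h

theorem Q_comp_shift_mul (k : ℕ+) : (Q n k).comp (shift n) * R n n = Q n (k + 1) := by
  have h := congrArg (fun ξ : Y n => (ξ : C⋆ᵐᵒᵈ(B n, EdgeY n → B n)) none)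
    (left_Q_y (n := n) (k := k))
  change (Q n k).comp (shift n) * (y n : C⋆ᵐᵒᵈ(B n, EdgeY n → B n)) none =
    Q n (k + 1) * (y n : C⋆ᵐᵒᵈ(B n, EdgeY n → B n)) none at h
  rw [y_eq_single, gen_apply, if_pos rfl] at h
  exact h.trans (Q_mul_R.trans (if_pos rfl))

-- From covariant representations of `X` to those of `Y`.

section FromXToY

variable {D : Type w} [NonUnitalCStarAlgebra D] (ρ : CovariantRep (actionX n) D)

namespace CovX

theorem isom_mul_P (k : ℕ) : isom ρ * vertexProj ρ k =
    (if n = k then edge ρ n n else 0) + if n + 1 = k then edge ρ n (n + 1) else 0 := by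
  rw [isom, add_mul, w_mul_P, w_mul_P]

/-- The source projection `P_n + P_{n+1}` of `s` is orthogonal to `P_i`, under which the range of
`w_{i,j}` lies. -/
theorem isom_mul_w {i j : ℕ} (hi : i < n) : isom ρ * edge ρ i j = 0 := by
  have h : isom ρ = isom ρ * vertexProj ρ n + isom ρ * vertexProj ρ (n + 1) := by
    rw [isom_mul_P, isom_mul_P]; simp [isom]
  rw [h, add_mul, mul_assoc, mul_assoc, P_mul_w, P_mul_w, if_neg (by omega), if_neg (by omega)]
  simp

theorem range_mul_w {i j : ℕ} (hi : i < n) (k : ℕ+) : range ρ k * edge ρ i j = 0 := by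
  have h : range ρ k * vertexProj ρ n = range ρ k := by
    have h' := congrArg star (P_mul_range ρ n k)
    rwa [if_pos rfl, star_mul, star_toA_P, star_tower (star_toA_P ρ _)] at h'
  rw [← h, mul_assoc, P_mul_w, if_neg hi.ne, mul_zero]

theorem star_isom_mul_P (hn : 1 ≤ n) : star (isom ρ) * vertexProj ρ n = star (isom ρ) := by
  rw [← star_toA_P, ← star_mul, P_mul_isom, if_pos rfl]

/-- The projection `s⋆s` dominates every stage of the tower. With `y = s⋆` this is the relation `Q_j
y = y Q_{j+1}`, and for `j = 0` the relation `R_{n+1} y = y Q_1`. -/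
theorem star_isom_mul_range (hn : 1 ≤ n) (j : ℕ) :
    star (isom ρ) * range ρ (j + 1) = range ρ j * star (isom ρ) := by
  have h : star (isom ρ) * isom ρ * range ρ j = range ρ j := by
    cases j with
    | zero =>
      change _ * vertexProj ρ (n + 1) = vertexProj ρ (n + 1)
      rw [star_isom_mul_isom ρ hn, add_mul, toA_P_mul_P, toA_P_mul_P, if_pos rfl,
        if_neg (by omega), zero_add]
    | succ j => exact mul_tower_of_mul (isom_hyp ρ hn) j
  change star (isom ρ) * (isom ρ * range ρ j * star (isom ρ)) = _
  rw [← mul_assoc, ← mul_assoc, h]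

/-- The images of the generators of `Y`. -/
def genY : EdgeY n → D
  | .some e => edge ρ e.1.1 e.1.2
  | .none => star (isom ρ)

/-- The generator `y` contributes `s⋆s = P_n + P_{n+1}`, and the `x_{i,j}` contribute `P_1, …,
P_{n-1}` by the Cuntz–Krieger relations. Since the total is the image of the unit, covariance for
`Y` holds at every element of `B`. -/
theorem sum_genY (hn : 1 ≤ n) : ∑ e, genY ρ e * star (genY ρ e) = ρ.toA 1 := by
  rw [Fintype.sum_option]
  change star (isom ρ) * star (star (isom ρ)) +
    ∑ e : {e : V n × V n // (e.1 : ℕ) < n ∧ (e.1 : ℕ) ≤ e.2},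
    edge ρ e.1.1 e.1.2 * star (edge ρ e.1.1 e.1.2) = ρ.toA 1
  rw [sum_edges (· < n) fun i j => edge ρ i j * star (edge ρ i j), star_star,
    star_isom_mul_isom ρ hn, ← sum_P, map_sum, sum_Icc_eq, sum_filter_le_eq hn]
  rw [Finset.sum_congr rfl fun i hi => ?_]
  · unfold vertexProj
    abel
  · rw [Finset.mem_filter, Finset.mem_Icc] at hi
    exact sum_w_mul_star ρ hi.1.1 hi.2.le

/-- The left action of `B` on the summands of `Y`. -/
abbrev leftY (n : ℕ) : EdgeY n → B n →⋆ₐ[ℂ] B n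
  | .some e => (StarAlgHom.ofId ℂ (B n)).comp
      (ContinuousMap.evalStarAlgHom ℂ ℂ (Sum.inl ⟨e.1.1, e.2.1.ne⟩ : K n))
  | .none => (shift n).compStarAlgHom' ℂ ℂ

theorem star_genY_mul_self (hn : 1 ≤ n) (e : EdgeY n) :
    star (genY ρ e) * genY ρ e = coeffHom ρ hn (projY n e) := by
  revert e
  rintro (_ | ⟨⟨⟨i, hi⟩, ⟨j, hj⟩⟩, h1, h2⟩)
  · change star (star (isom ρ)) * star (isom ρ) = coeffHom ρ hn (R n n)
    rw [star_star, isom_mul_star_isom ρ hn, coeffHom_R ρ hn hn n.le_succ]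
  · rw [Finset.mem_Icc] at hi hj
    change star (edge ρ i j) * edge ρ i j = coeffHom ρ hn (R n j)
    rw [coeffHom_R ρ hn hj.1 hj.2]
    exact star_w_mul_w_self ρ hi.1 h1.le h2 hj.2

theorem star_genY_mul (e f : EdgeY n) (h : e ≠ f) : star (genY ρ e) * genY ρ f = 0 := by
  revert e f
  rintro (_ | ⟨⟨⟨i, hi⟩, ⟨j, hj⟩⟩, h1, h2⟩) (_ | ⟨⟨⟨i', hi'⟩, ⟨j', hj'⟩⟩, h1', h2'⟩) h
  · exact absurd rfl h
  · change star (star (isom ρ)) * edge ρ i' j' = 0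
    rw [star_star, isom_mul_w ρ h1']
  · change star (edge ρ i j) * star (isom ρ) = 0
    rw [← star_mul, isom_mul_w ρ h1, star_zero]
  · refine star_w_mul_w ρ fun h' => h ?_
    obtain ⟨rfl : i = i', rfl : j = j'⟩ := h'
    rfl

theorem coeffHom_mul_genY (hn : 1 ≤ n) (b : B n) (e : EdgeY n) :
    coeffHom ρ hn b * genY ρ e = genY ρ e * coeffHom ρ hn (leftY n e b * projY n e) := by
  refine intertwine_of_generators hn (coeffHom ρ hn) _ _ _ ?_ ?_ b
  · intro k hk hk'
    rcases e with _ | ⟨⟨⟨i, hi⟩, ⟨j, hj⟩⟩, h1, h2⟩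
    · change coeffHom ρ hn (R n k) * star (isom ρ) =
        star (isom ρ) * coeffHom ρ hn ((R n k).comp (shift n) * R n n)
      have hQR : Q n 1 * R n n = Q n 1 := Q_mul_R.trans (if_pos rfl)
      have hstar : vertexProj ρ n * star (isom ρ) + vertexProj ρ (n + 1) * star (isom ρ) =
          star (isom ρ) := by
        rw [← star_toA_P, ← star_toA_P ρ (n + 1), ← star_mul, ← star_mul, isom_mul_P,
          isom_mul_P]
        simp [isom]
      have hr : star (isom ρ) * range ρ (1 : ℕ+) = vertexProj ρ (n + 1) * star (isom ρ) :=
        star_isom_mul_range ρ hn 0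
      rw [coeffHom_R ρ hn hk hk', R_comp_shift_mul]
      by_cases h : n = k
      · subst h
        -- Here `φ_Y(R_n) y = y - y Q_1` amounts to `P_n s⋆ = s⋆ - P_{n+1} s⋆`.
        rw [if_pos rfl, if_neg (by omega), add_zero, sub_mul, one_mul, hQR, map_sub,
          coeffHom_R ρ hn hn n.le_succ, coeffHom_Q, mul_sub, star_isom_mul_P ρ hn, hr,
          eq_sub_iff_add_eq, hstar]
      · by_cases h' : n + 1 = k
        · subst h'
          rw [if_neg h, if_pos rfl, zero_add, hQR, coeffHom_Q, hr]
        · rw [if_neg h, if_neg h', add_zero, zero_mul, map_zero, mul_zero, ← star_toA_P,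
            ← star_mul, isom_mul_P, if_neg h, if_neg h', add_zero, star_zero]
    · rw [Finset.mem_Icc] at hi hj
      change coeffHom ρ hn (R n k) * edge ρ i j = edge ρ i j *
        coeffHom ρ hn (algebraMap ℂ (B n) (if i = k then 1 else 0) * R n j)
      rw [coeffHom_R ρ hn hk hk', P_mul_w]
      split_ifs
      · rw [map_one, one_mul, coeffHom_R ρ hn hj.1 hj.2, w_mul_P, if_pos rfl]
      · rw [map_zero, zero_mul, map_zero, mul_zero]
  · intro k
    rw [coeffHom_Q]
    rcases e with _ | ⟨⟨⟨i, hi⟩, ⟨j, hj⟩⟩, h1, h2⟩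
    · change range ρ k * star (isom ρ) =
        star (isom ρ) * coeffHom ρ hn ((Q n k).comp (shift n) * R n n)
      rw [Q_comp_shift_mul, coeffHom_Q]
      exact (star_isom_mul_range ρ hn k).symm
    · change range ρ k * edge ρ i j = edge ρ i j *
        coeffHom ρ hn (algebraMap ℂ (B n) 0 * R n j)
      rw [map_zero, zero_mul, map_zero, mul_zero, range_mul_w ρ h1]

/-- The covariant representation of `Y` determined by a covariant representation of `X`. -/
def toCovY (hn : 1 ≤ n) : CovariantRep (actionY n) D :=
  diagCovariantRep (p := projY n) (l := leftY n) (projY_mul_self n) (coeffHom ρ hn) (genY ρ)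
    star_projY (star_genY_mul_self ρ hn) (star_genY_mul ρ) (coeffHom_mul_genY ρ hn)
    fun b _ => by rw [sum_genY ρ hn, ← coeffHom_one ρ hn, ← map_mul, mul_one]

theorem toCovY_R (hn : 1 ≤ n) {i : ℕ} (hi : 1 ≤ i) (hi' : i ≤ n + 1) :
    (toCovY ρ hn).toA (R n i) = vertexProj ρ i := coeffHom_R ρ hn hi hi'

theorem toCovY_Q (hn : 1 ≤ n) (j : ℕ+) : (toCovY ρ hn).toA (Q n j) = range ρ j :=
  coeffHom_Q ρ hn j

theorem toCovY_single (hn : 1 ≤ n) (e : EdgeY n) :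
    (toCovY ρ hn).toE (single (projY_mul_self n) e) = genY ρ e :=
  diagRepresentation_single (l := leftY n) (projY_mul_self n) (coeffHom ρ hn) (genY ρ)
    (star_genY_mul_self ρ hn) (star_genY_mul ρ) (coeffHom_mul_genY ρ hn) e

theorem toCovY_y (hn : 1 ≤ n) : (toCovY ρ hn).toE (y n) = star (isom ρ) :=
  toCovY_single ρ hn none

theorem toCovY_x (hn : 1 ≤ n) {i j : ℕ} (hi : 1 ≤ i) (hin : i < n) (hij : i ≤ j)
    (hj : j ≤ n + 1) : (toCovY ρ hn).toE (x n i j) = edge ρ i j := by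
  have h := x_eq_single (n := n) ⟨(⟨i, by simp; omega⟩, ⟨j, by simp; omega⟩), hin, hij⟩
  exact (congrArg _ h).trans (toCovY_single ρ hn _)

end CovX

end FromXToY

-- From covariant representations of `Y` to those of `X`.

section RepresentationsOfY

variable {D : Type w} [NonUnitalCStarAlgebra D] (ρ : CovariantRep (actionY n) D)

namespace CovY

/-- The image of `R_i`. -/
def vertexProj (i : ℕ) : D := ρ.toA (R n i)

/-- The image of `Q_j`. -/
def seqProj (j : ℕ+) : D := ρ.toA (Q n j)

/-- The image of `x_{i,j}`. -/
def edge (i j : ℕ) : D := ρ.toE (x n i j)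

/-- The image of `y`. -/
def loop : D := ρ.toE (y n)

/-- The image of `y'`. -/
def loopPrime : D := ρ.toE (yPrime n)

theorem R_mul_x (i j k : ℕ) :
    vertexProj ρ k * edge ρ i j = if i = k then edge ρ i j else 0 := by
  unfold vertexProj edge
  rw [← ρ.left_eq, left_R_x]
  split_ifs
  · rw [one_op_smul]
  · rw [zero_op_smul, map_zero]

theorem x_mul_R (i j k : ℕ) :
    edge ρ i j * vertexProj ρ k = if j = k then edge ρ i j else 0 := by
  unfold vertexProj edge
  rw [← ρ.toE_op_smul, R_smul_x]
  split_ifs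
  · rw [one_op_smul]
  · rw [zero_op_smul, map_zero]

theorem y_mul_R (k : ℕ) : loop ρ * vertexProj ρ k = if n = k then loop ρ else 0 := by
  unfold vertexProj loop
  rw [← ρ.toE_op_smul, R_smul_y]
  split_ifs
  · rw [one_op_smul]
  · rw [zero_op_smul, map_zero]

theorem star_toA_R (i : ℕ) : star (vertexProj ρ i) = vertexProj ρ i := by
  unfold vertexProj
  rw [← map_star, star_R]

theorem toA_R_mul_R (i j : ℕ) :
    vertexProj ρ i * vertexProj ρ j = if i = j then vertexProj ρ i else 0 := by
  unfold vertexProj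
  rw [← map_mul, R_mul_R]; split_ifs <;> simp

theorem toE_yPrime : loopPrime ρ = loop ρ * seqProj ρ 1 := ρ.toE_op_smul _ _

theorem R_mul_y (k : ℕ) : vertexProj ρ k * loop ρ =
    (if n = k then loop ρ - loopPrime ρ else 0) +
      if n + 1 = k then loopPrime ρ else 0 := by
  have h : vertexProj ρ k * loop ρ = loop ρ * (ρ.toA (if n = k then 1 - Q n 1 else 0) +
      ρ.toA (if n + 1 = k then Q n 1 else 0)) := by
    unfold vertexProj loop
    rw [← ρ.left_eq, left_R_y, ρ.toE_op_smul, map_add]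
  have h1 : loop ρ * ρ.toA 1 = loop ρ :=
    (ρ.toE_op_smul 1 (y n)).symm.trans (congrArg ρ.toE (one_op_smul _))
  rw [h, mul_add]
  congr 1
  · split_ifs
    · rw [map_sub, mul_sub, h1, toE_yPrime]; rfl
    · rw [map_zero, mul_zero]
  · split_ifs
    · exact (toE_yPrime ρ).symm
    · rw [map_zero, mul_zero]

theorem y_mul_x {i j : ℕ} (hi : i < n) : loop ρ * edge ρ i j = 0 := by
  have h := y_mul_R ρ n
  rw [if_pos rfl] at h
  rw [← h, mul_assoc, R_mul_x, if_neg hi.ne, mul_zero]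

theorem star_y_mul_y : star (loop ρ) * loop ρ = vertexProj ρ n := by
  unfold loop vertexProj
  rw [ρ.inner_eq, inner_y_self]

theorem star_x_mul_x_self {i j : ℕ} (hi : 1 ≤ i) (hin : i < n) (hij : i ≤ j) (hj : j ≤ n + 1) :
    star (edge ρ i j) * edge ρ i j = vertexProj ρ j := by
  unfold edge vertexProj
  rw [ρ.inner_eq, inner_x_self hi hin hij hj]

theorem star_x_mul_x {i j k l : ℕ} (h : ¬ (i = k ∧ j = l)) :
    star (edge ρ i j) * edge ρ k l = 0 := by
  unfold edge
  rw [ρ.inner_eq, inner_x_of_ne h, map_zero]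

/-- The left action on `Y` is faithful. -/
theorem eq_zero_of_left (c : B n) (hx : ∀ v : V n, ∀ h : (v : ℕ) < n,
    c (Sum.inl ⟨v, h.ne⟩) • R n v = 0) (hy : c.comp (shift n) * R n n = 0) : c = 0 := by
  have hR : ∀ t, R n n (Sum.inr t) = 1 := fun t => if_pos rfl
  -- The summand `yB` detects `c` on the image under `shift` of the support of `R_n`: the point of
  -- `R_{n+1}` comes from `Q_1`, that of `Q_k` from `Q_{k+1}`, and the limit point from itself. The
  -- points of `R_i` with `i < n` are left to `hx`.
  have hinr : ∀ t, c (shift n (Sum.inr t)) = 0 := fun t => by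
    have h : c (shift n (Sum.inr t)) * R n n (Sum.inr t) = 0 := congrArg (· (Sum.inr t)) hy
    rwa [hR, mul_one] at h
  ext (v | t)
  · obtain ⟨⟨v, hv⟩, hvn⟩ := v
    have hv' := Finset.mem_Icc.1 hv
    rcases lt_or_gt_of_ne hvn with h | h
    · have h2 := congrArg (· (Sum.inl ⟨⟨v, hv⟩, hvn⟩)) (hx ⟨v, hv⟩ h)
      simpa [R] using h2
    · obtain rfl : v = n + 1 := by
        have : n < v := h
        omega
      simpa [shift_coe] using hinr ((1 : ℕ+) : OnePoint ℕ+)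
  · induction t using OnePoint.rec with
    | infty => simpa [shift_infty] using hinr ∞
    | coe k =>
      have h := hinr ((k + 1 : ℕ+) : OnePoint ℕ+)
      have hk : k + 1 ≠ 1 := (PNat.lt_add_left 1 k).ne'
      have hk' : k + 1 - 1 = k := by simp
      rw [shift_coe, if_neg hk, hk'] at h
      exact h

/-- By faithfulness of the left action Katsura's ideal is the whole of `B`, so covariance holds at
every `b`. Multiplying by a suitable `R_k` then isolates one relation at a time. -/
theorem sum_gen (b : B n) : ρ.toA b * (loop ρ * star (loop ρ) +
    ∑ i ∈ (Finset.Icc 1 (n + 1)).filter (· < n), ∑ j ∈ Finset.Icc i (n + 1),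
      edge ρ i j * star (edge ρ i j)) = ρ.toA b := by
  rw [← sum_edges (· < n) fun i j => edge ρ i j * star (edge ρ i j)]
  simp only [edge, loop, x_eq_single, y_eq_single]
  rw [← Fintype.sum_option (f := fun e => ρ.toE (single (projY_mul_self n) e) *
    star (ρ.toE (single (projY_mul_self n) e)))]
  refine ρ.diag_covariant (projY_mul_self n) star_projY fun c hc => ?_
  rw [eq_zero_of_left c ?_ (hc none), mul_zero]
  intro v h
  -- The generator `x_{v,v}` detects the value of `c` at the point of `R_v`.
  have := hc (Option.some ⟨(v, v), h, le_rfl⟩)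
  rw [Algebra.smul_def]
  exact this

theorem R_mul_sum {k i : ℕ} : vertexProj ρ k * ∑ j ∈ Finset.Icc i (n + 1),
    edge ρ i j * star (edge ρ i j) =
      if i = k then ∑ j ∈ Finset.Icc i (n + 1), edge ρ i j * star (edge ρ i j) else 0 := by
  rw [Finset.mul_sum]
  split_ifs with h
  · refine Finset.sum_congr rfl fun j _ => ?_
    rw [← mul_assoc, R_mul_x, if_pos h]
  · refine Finset.sum_eq_zero fun j _ => ?_
    rw [← mul_assoc, R_mul_x, if_neg h, zero_mul]

theorem sum_x_mul_star {k : ℕ} (hk : 1 ≤ k) (hkn : k < n) :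
    ∑ j ∈ Finset.Icc k (n + 1), edge ρ k j * star (edge ρ k j) = vertexProj ρ k := by
  refine Eq.trans (Eq.symm ?_) (sum_gen ρ (R n k))
  change vertexProj ρ k * _ = _
  rw [mul_add, ← mul_assoc, R_mul_y, if_neg (by omega), if_neg (by omega), add_zero, zero_mul,
    zero_add, Finset.mul_sum]
  simp only [R_mul_sum]
  rw [Finset.sum_ite_eq', if_pos (by simp; omega)]

/-- For `k = n` and `k = n + 1` multiplication of `sum_gen` by `R_k` kills all the `x_{i,j}`,
leaving `R_k yy⋆ = R_k`. Since `y = (R_n + R_{n+1}) y`, adding the two gives the claim. -/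
theorem y_mul_star_y : loop ρ * star (loop ρ) =
    vertexProj ρ n + vertexProj ρ (n + 1) := by
  have h : ∀ k, n ≤ k → vertexProj ρ k * (loop ρ * star (loop ρ)) = vertexProj ρ k := by
    intro k hk
    refine Eq.trans (Eq.symm ?_) (sum_gen ρ (R n k))
    change vertexProj ρ k * _ = _
    rw [mul_add, Finset.mul_sum]
    simp only [R_mul_sum]
    rw [Finset.sum_ite_eq', if_neg (by simp; omega), add_zero]
  have hy : loop ρ = (vertexProj ρ n + vertexProj ρ (n + 1)) * loop ρ := by
    rw [add_mul, R_mul_y, R_mul_y]; simp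
  have h1 := h n le_rfl
  have h2 := h (n + 1) n.le_succ
  clear h
  generalize loop ρ = Y at *
  generalize vertexProj ρ n = p at *
  generalize vertexProj ρ (n + 1) = q at *
  calc Y * star Y = (p + q) * Y * star Y := congrArg (· * star Y) hy
    _ = p + q := by rw [mul_assoc, add_mul, h1, h2]

/-- The inclusion `A → B`, `P_i ↦ R_i`. -/
def inclusion (hn : 1 ≤ n) : A n →⋆ₙₐ[ℂ] B n where
  toFun a := ⟨fun k => a (Sum.elim (fun v => v.1) (fun _ => ⟨n, by simp [hn]⟩) k),
    (continuous_of_discreteTopology (f := a)).comp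
      (continuous_of_discreteTopology.sumElim continuous_const)⟩
  map_add' _ _ := rfl
  map_smul' _ _ := rfl
  map_zero' := rfl
  map_mul' _ _ := rfl
  map_star' _ := rfl

theorem inclusion_P (hn : 1 ≤ n) (i : ℕ) : inclusion hn (P n i) = R n i := by
  ext (v | t)
  · rfl
  · change (if n = i then (1 : ℂ) else 0) = if i = n then 1 else 0
    simp [eq_comm]

theorem toA_inclusion_P (hn : 1 ≤ n) (i : ℕ) :
    ρ.toA (inclusion hn (P n i)) = vertexProj ρ i := congrArg ρ.toA (inclusion_P hn i)

/-- The image of `w_{i,j}`. -/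
def imageW (i j : ℕ) : D :=
  if i < n then edge ρ i j else star (loop ρ) * vertexProj ρ j

theorem imageW_of_lt {i j : ℕ} (h : i < n) : imageW ρ i j = edge ρ i j := if_pos h

theorem imageW_self (j : ℕ) : imageW ρ n j = star (loop ρ) * vertexProj ρ j :=
  if_neg (lt_irrefl n)

/-- The product is `R_j yy⋆ R_l`, and `yy⋆` acts as a unit on `R_n` and `R_{n+1}`. This is where
covariance of `Y` yields the inner products of the new edges. -/
theorem star_imageW_self_mul {j l : ℕ} (hj : n ≤ j) (hj' : j ≤ n + 1) :
    star (imageW ρ n j) * imageW ρ n l = if j = l then vertexProj ρ j else 0 := by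
  rw [imageW_self, imageW_self, star_mul, star_star, star_toA_R, mul_assoc,
    ← mul_assoc (loop ρ), y_mul_star_y, ← mul_assoc, mul_add, toA_R_mul_R, toA_R_mul_R]
  obtain rfl | rfl : j = n ∨ j = n + 1 := by omega
  · rw [if_pos rfl, if_neg (by omega), add_zero, toA_R_mul_R]
  · rw [if_pos rfl, if_neg (by omega), zero_add, toA_R_mul_R]

theorem R_mul_imageW {i : ℕ} (hi : i ≤ n) (j k : ℕ) :
    vertexProj ρ k * imageW ρ i j = if i = k then imageW ρ i j else 0 := by
  rcases hi.lt_or_eq with h | rfl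
  · rw [imageW_of_lt ρ h, R_mul_x]
  · rw [imageW_self, ← mul_assoc, ← star_toA_R, ← star_mul, y_mul_R]
    split_ifs <;> simp

theorem imageW_mul_R {i : ℕ} (hi : i ≤ n) (j : ℕ) :
    imageW ρ i j * vertexProj ρ j = imageW ρ i j := by
  rcases hi.lt_or_eq with h | rfl
  · rw [imageW_of_lt ρ h, x_mul_R, if_pos rfl]
  · rw [imageW_self, mul_assoc, toA_R_mul_R, if_pos rfl]

/-- The sum is `y⋆ (R_n + R_{n+1}) y = y⋆y = R_n`, the Cuntz–Krieger relation at `v_n`. -/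
theorem sum_imageW_self : ∑ j ∈ Finset.Icc n (n + 1), imageW ρ n j * star (imageW ρ n j) =
    vertexProj ρ n := by
  have h : ∀ j, imageW ρ n j * star (imageW ρ n j) =
      star (loop ρ) * (vertexProj ρ j * loop ρ) := fun j => by
    rw [imageW_self, star_mul, star_star, star_toA_R, mul_assoc, ← mul_assoc (vertexProj ρ j),
      toA_R_mul_R, if_pos rfl]
  rw [Icc_succ_eq, Finset.sum_pair (by omega), h, h, ← mul_add, R_mul_y, R_mul_y]
  simp [star_y_mul_y]

theorem sum_imageW (hn : 1 ≤ n) : ∑ e : EdgeX n, imageW ρ e.1.1 e.1.2 *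
    star (imageW ρ e.1.1 e.1.2) = ∑ i ∈ (Finset.Icc 1 (n + 1)).filter (· ≤ n), vertexProj ρ i := by
  rw [sum_edges (· ≤ n) fun i j => imageW ρ i j * star (imageW ρ i j)]
  refine Finset.sum_congr rfl fun i hi => ?_
  rw [Finset.mem_filter, Finset.mem_Icc] at hi
  rcases hi.2.lt_or_eq with h | rfl
  · simp only [imageW_of_lt ρ h]
    exact sum_x_mul_star ρ hi.1.1 h
  · exact sum_imageW_self ρ

/-- The left action of `A` on the summands of `X`. -/
abbrev leftX (n : ℕ) (e : EdgeX n) : A n →⋆ₐ[ℂ] A n :=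
  (StarAlgHom.ofId ℂ (A n)).comp (Pi.evalStarAlgHom ℂ (fun _ : V n => ℂ) e.1.1)

theorem star_imageW_mul_self (hn : 1 ≤ n) (e : EdgeX n) :
    star (imageW ρ e.1.1 e.1.2) * imageW ρ e.1.1 e.1.2 = ρ.toA (inclusion hn (projX n e)) := by
  revert e
  rintro ⟨⟨⟨i, hi⟩, ⟨j, hj⟩⟩, h1, h2⟩
  rw [Finset.mem_Icc] at hi hj
  change star (imageW ρ i j) * imageW ρ i j = ρ.toA (inclusion hn (P n j))
  rw [toA_inclusion_P]
  rcases (show i ≤ n from h1).lt_or_eq with h | rfl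
  · rw [imageW_of_lt ρ h, star_x_mul_x_self ρ hi.1 h h2 hj.2]
  · rw [star_imageW_self_mul ρ h2 hj.2, if_pos rfl]

theorem star_imageW_mul (e f : EdgeX n) (hef : e ≠ f) :
    star (imageW ρ e.1.1 e.1.2) * imageW ρ f.1.1 f.1.2 = 0 := by
  revert e f
  rintro ⟨⟨⟨i, hi⟩, ⟨j, hj⟩⟩, h1, h2⟩ ⟨⟨⟨i', hi'⟩, ⟨j', hj'⟩⟩, h1', h2'⟩ hne
  rw [Finset.mem_Icc] at hi hj hi' hj'
  change star (imageW ρ i j) * imageW ρ i' j' = 0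
  have hne' : ¬ (i = i' ∧ j = j') := by
    rintro ⟨rfl, rfl⟩
    exact hne rfl
  rcases (show i ≤ n from h1).lt_or_eq with h | rfl <;>
    rcases (show i' ≤ _ from h1').lt_or_eq with h' | rfl
  · rw [imageW_of_lt ρ h, imageW_of_lt ρ h', star_x_mul_x ρ hne']
  · rw [imageW_of_lt ρ h, imageW_self, ← mul_assoc, ← star_mul, y_mul_x ρ h, star_zero,
      zero_mul]
  · rw [imageW_of_lt ρ h', imageW_self, star_mul, star_star, mul_assoc, y_mul_x ρ h', mul_zero]
  · rw [star_imageW_self_mul ρ h2 hj.2, if_neg fun h => hne' ⟨rfl, h⟩]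

theorem inclusion_mul_imageW (hn : 1 ≤ n) (a : A n) (e : EdgeX n) :
    ρ.toA (inclusion hn a) * imageW ρ e.1.1 e.1.2 =
      imageW ρ e.1.1 e.1.2 * ρ.toA (inclusion hn (leftX n e a * projX n e)) := by
  revert a e
  rintro a ⟨⟨⟨i, hi⟩, ⟨j, hj⟩⟩, h1, h2⟩
  change ρ.toA (inclusion hn a) * imageW ρ i j = imageW ρ i j *
    ρ.toA (inclusion hn (algebraMap ℂ (A n) (a ⟨i, hi⟩) * P n j))
  have h3 : ∀ c : ℂ, imageW ρ i j * ρ.toA (inclusion hn (algebraMap ℂ (A n) c * P n j)) =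
      c • imageW ρ i j := fun c => by
    rw [← Algebra.smul_def, map_smul, map_smul, toA_inclusion_P, mul_smul_comm, imageW_mul_R ρ h1]
  rw [h3]
  let S : Submodule ℂ (A n) :=
    { carrier := {a | ρ.toA (inclusion hn a) * imageW ρ i j = a ⟨i, hi⟩ • imageW ρ i j}
      add_mem' := fun {a b} ha hb => by
        change ρ.toA (inclusion hn (a + b)) * imageW ρ i j = (a + b) ⟨i, hi⟩ • imageW ρ i j
        rw [map_add, map_add, add_mul, ha, hb, Pi.add_apply, add_smul]
      zero_mem' := by
        change ρ.toA (inclusion hn 0) * imageW ρ i j = (0 : ℂ) • imageW ρ i j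
        simp
      smul_mem' := fun c b hb => by
        change ρ.toA (inclusion hn (c • b)) * imageW ρ i j = (c • b) ⟨i, hi⟩ • imageW ρ i j
        rw [map_smul, map_smul, smul_mul_assoc, hb, Pi.smul_apply, smul_assoc] }
  refine A_induction S (fun k _ _ => ?_) a
  change ρ.toA (inclusion hn (P n k)) * imageW ρ i j = (if i = k then (1 : ℂ) else 0) • _
  rw [toA_inclusion_P, R_mul_imageW ρ h1]
  split_ifs <;> simp

/-- No edge leaves `v_{n+1}`, so `P_{n+1}` acts as zero and is annihilated by `b`. Therefore `b = b
(P_1 + ⋯ + P_n)`, and the sum over edges is the image of `P_1 + ⋯ + P_n`. -/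
theorem inclusion_mul_sum (hn : 1 ≤ n) (b : A n)
    (hb : ∀ c, (∀ e, leftX n e c * projX n e = 0) → b * c = 0) :
    ρ.toA (inclusion hn b) * ∑ e : EdgeX n, imageW ρ e.1.1 e.1.2 * star (imageW ρ e.1.1 e.1.2) =
      ρ.toA (inclusion hn b) := by
  have hb' : b * P n (n + 1) = 0 := by
    refine hb _ fun e => ?_
    have h := e.2.1
    have h0 : P n (n + 1) e.1.1 = 0 := if_neg (by omega)
    change algebraMap ℂ (A n) (P n (n + 1) e.1.1) * _ = 0
    rw [h0, map_zero, zero_mul]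
  have h1 : (1 : A n) = P n (n + 1) +
      ∑ i ∈ (Finset.Icc 1 (n + 1)).filter (· ≤ n), P n i := by
    rw [← sum_P, sum_Icc_eq]
  have h2 : ∑ i ∈ (Finset.Icc 1 (n + 1)).filter (· ≤ n), vertexProj ρ i =
      ρ.toA (inclusion hn (∑ i ∈ (Finset.Icc 1 (n + 1)).filter (· ≤ n), P n i)) := by
    rw [map_sum, map_sum]
    simp only [toA_inclusion_P]
  rw [sum_imageW ρ hn, h2]
  rw [← map_mul, ← map_mul]
  conv_rhs => rw [← mul_one b, h1, mul_add, hb', zero_add]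

/-- The covariant representation of `X` determined by a covariant representation of `Y`. -/
def toCovX (hn : 1 ≤ n) : CovariantRep (actionX n) D :=
  diagCovariantRep (p := projX n) (l := leftX n) (projX_mul_self n) (ρ.toA.comp (inclusion hn))
    (fun e => imageW ρ e.1.1 e.1.2) star_projX (star_imageW_mul_self ρ hn) (star_imageW_mul ρ)
    (inclusion_mul_imageW ρ hn) (inclusion_mul_sum ρ hn)

theorem toCovX_P (hn : 1 ≤ n) (i : ℕ) : (toCovX ρ hn).toA (P n i) = vertexProj ρ i :=
  toA_inclusion_P ρ hn i

theorem toCovX_single (hn : 1 ≤ n) (e : EdgeX n) :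
    (toCovX ρ hn).toE (single (projX_mul_self n) e) = imageW ρ e.1.1 e.1.2 :=
  diagRepresentation_single (l := leftX n) (projX_mul_self n) (ρ.toA.comp (inclusion hn))
    (fun e => imageW ρ e.1.1 e.1.2) (star_imageW_mul_self ρ hn) (star_imageW_mul ρ)
    (inclusion_mul_imageW ρ hn) e

theorem toCovX_w (hn : 1 ≤ n) {i j : ℕ} (hi : 1 ≤ i) (hin : i ≤ n) (hij : i ≤ j)
    (hj : j ≤ n + 1) : (toCovX ρ hn).toE (w n i j) = imageW ρ i j := by
  have h := w_eq_single (n := n) ⟨(⟨i, by simp; omega⟩, ⟨j, by simp; omega⟩), hin, hij⟩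
  exact (congrArg _ h).trans (toCovX_single ρ hn _)

end CovY

end RepresentationsOfY

end QuantumDisc

end CStarCorr

namespace CStarCorr

namespace QuantumDisc

universe u v w

open Filter Topology

variable {n : ℕ} {D : Type u} {E : Type v} [NonUnitalCStarAlgebra D] [NonUnitalCStarAlgebra E]

theorem map_tower (f : D →⋆ₙₐ[ℂ] E) (s p : D) (j : ℕ) :
    f (tower s p j) = tower (f s) (f p) j := by
  induction j with
  | zero => rfl
  | succ j ih => rw [tower, map_mul, map_mul, map_star, ih, tower]

theorem A_hom_ext {f g : A n →⋆ₙₐ[ℂ] D}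
    (h : ∀ i, 1 ≤ i → i ≤ n + 1 → f (P n i) = g (P n i)) (c : A n) : f c = g c :=
  A_induction (LinearMap.eqLocus (f : A n →ₗ[ℂ] D) (g : A n →ₗ[ℂ] D)) h c

theorem B_hom_ext (hn : 1 ≤ n) {f g : B n →⋆ₙₐ[ℂ] D}
    (hR : ∀ i, 1 ≤ i → i ≤ n + 1 → f (R n i) = g (R n i))
    (hQ : ∀ j, f (Q n j) = g (Q n j)) (b : B n) : f b = g b :=
  B_induction hn (LinearMap.eqLocus (f : B n →ₗ[ℂ] D) (g : B n →ₗ[ℂ] D))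
    (isClosed_eq (continuous_starHom f) (continuous_starHom g)) hR hQ b

-- Both constructions commute with homomorphisms of the target algebra.

section Naturality

theorem map_toCovX_toA (hn : 1 ≤ n) (ρ : CovariantRep (actionY n) D)
    (ρ' : CovariantRep (actionY n) E) (f : D →⋆ₙₐ[ℂ] E) (hA : ∀ b, f (ρ.toA b) = ρ'.toA b)
    (c : A n) : f ((CovY.toCovX ρ hn).toA c) = (CovY.toCovX ρ' hn).toA c := hA _

theorem map_imageW (ρ : CovariantRep (actionY n) D)
    (ρ' : CovariantRep (actionY n) E) (f : D →⋆ₙₐ[ℂ] E) (hE : ∀ ξ, f (ρ.toE ξ) = ρ'.toE ξ)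
    (hA : ∀ b, f (ρ.toA b) = ρ'.toA b) (i j : ℕ) :
    f (CovY.imageW ρ i j) = CovY.imageW ρ' i j := by
  unfold CovY.imageW
  split_ifs
  · exact hE _
  · rw [map_mul, map_star]
    exact congrArg₂ (fun a b => star a * b) (hE _) (hA _)

theorem map_toCovX_toE (hn : 1 ≤ n) (ρ : CovariantRep (actionY n) D)
    (ρ' : CovariantRep (actionY n) E) (f : D →⋆ₙₐ[ℂ] E) (hE : ∀ ξ, f (ρ.toE ξ) = ρ'.toE ξ)
    (hA : ∀ b, f (ρ.toA b) = ρ'.toA b)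
    (ξ : X n) : f ((CovY.toCovX ρ hn).toE ξ) = (CovY.toCovX ρ' hn).toE ξ := by
  refine Representation.map_toE_of_single (l := CovY.leftX n) (projX_mul_self n)
    (CovY.toCovX ρ hn).toRepresentation (CovY.toCovX ρ' hn).toRepresentation f (fun e => ?_)
    (map_toCovX_toA hn ρ ρ' f hA) ξ
  exact (congrArg f (CovY.toCovX_single ρ hn e)).trans
    ((map_imageW ρ ρ' f hE hA _ _).trans (CovY.toCovX_single ρ' hn e).symm)

theorem map_isom (ρ : CovariantRep (actionX n) D) (ρ' : CovariantRep (actionX n) E)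
    (f : D →⋆ₙₐ[ℂ] E) (hE : ∀ ξ, f (ρ.toE ξ) = ρ'.toE ξ) :
    f (CovX.isom ρ) = CovX.isom ρ' := by
  unfold CovX.isom
  exact (map_add f _ _).trans (congrArg₂ (· + ·) (hE _) (hE _))

theorem map_toCovY_toA (hn : 1 ≤ n) (ρ : CovariantRep (actionX n) D)
    (ρ' : CovariantRep (actionX n) E) (f : D →⋆ₙₐ[ℂ] E) (hE : ∀ ξ, f (ρ.toE ξ) = ρ'.toE ξ)
    (hA : ∀ c, f (ρ.toA c) = ρ'.toA c)
    (b : B n) : f ((CovX.toCovY ρ hn).toA b) = (CovX.toCovY ρ' hn).toA b := by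
  refine B_hom_ext hn (f := f.comp (CovX.toCovY ρ hn).toA) (g := (CovX.toCovY ρ' hn).toA)
    (fun i hi hi' => ?_) (fun j => ?_) b
  · exact (congrArg f (CovX.toCovY_R ρ hn hi hi')).trans
      ((hA _).trans (CovX.toCovY_R ρ' hn hi hi').symm)
  · refine (congrArg f (CovX.toCovY_Q ρ hn j)).trans (Eq.trans ?_ (CovX.toCovY_Q ρ' hn j).symm)
    have h : f (CovX.vertexProj ρ (n + 1)) = CovX.vertexProj ρ' (n + 1) := hA _
    rw [CovX.range, map_tower, map_isom ρ ρ' f hE, h, CovX.range]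

theorem map_toCovY_toE (hn : 1 ≤ n) (ρ : CovariantRep (actionX n) D)
    (ρ' : CovariantRep (actionX n) E) (f : D →⋆ₙₐ[ℂ] E) (hE : ∀ ξ, f (ρ.toE ξ) = ρ'.toE ξ)
    (hA : ∀ c, f (ρ.toA c) = ρ'.toA c)
    (ξ : Y n) : f ((CovX.toCovY ρ hn).toE ξ) = (CovX.toCovY ρ' hn).toE ξ := by
  refine Representation.map_toE_of_single (l := CovX.leftY n) (projY_mul_self n)
    (CovX.toCovY ρ hn).toRepresentation (CovX.toCovY ρ' hn).toRepresentation f (fun e => ?_)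
    (map_toCovY_toA hn ρ ρ' f hE hA) ξ
  refine (congrArg f (CovX.toCovY_single ρ hn e)).trans
    (Eq.trans ?_ (CovX.toCovY_single ρ' hn e).symm)
  rcases e with _ | e
  · exact (map_star f _).trans (congrArg star (map_isom ρ ρ' f hE))
  · exact hE _

end Naturality

-- The two constructions are mutually inverse.

section RoundTrip

theorem star_y_mul_R_n (ρ : CovariantRep (actionY n) E) :
    star (CovY.loop ρ) * CovY.vertexProj ρ n = star (CovY.loop ρ) - star (CovY.loopPrime ρ) := by
  have h := CovY.R_mul_y ρ n
  rw [if_pos rfl, if_neg n.succ_ne_self, add_zero] at h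
  rw [← star_sub, ← h, star_mul, CovY.star_toA_R]

theorem star_y_mul_R_succ (ρ : CovariantRep (actionY n) E) :
    star (CovY.loop ρ) * CovY.vertexProj ρ (n + 1) = star (CovY.loopPrime ρ) := by
  have h := CovY.R_mul_y ρ (n + 1)
  rw [if_pos rfl, if_neg n.succ_ne_self.symm, zero_add] at h
  rw [← h, star_mul, CovY.star_toA_R]

theorem toCovX_w_n_n (hn : 1 ≤ n) (ρ : CovariantRep (actionY n) E) :
    (CovY.toCovX ρ hn).toE (w n n n) = star (CovY.loop ρ) - star (CovY.loopPrime ρ) :=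
  (CovY.toCovX_w ρ hn hn le_rfl le_rfl n.le_succ).trans
    ((CovY.imageW_self ρ n).trans (star_y_mul_R_n ρ))

theorem toCovX_w_n_succ (hn : 1 ≤ n) (ρ : CovariantRep (actionY n) E) :
    (CovY.toCovX ρ hn).toE (w n n (n + 1)) = star (CovY.loopPrime ρ) :=
  (CovY.toCovX_w ρ hn hn le_rfl n.le_succ le_rfl).trans
    ((CovY.imageW_self ρ (n + 1)).trans (star_y_mul_R_succ ρ))

/-- The two edges out of `v_n` go to `y⋆ - y'⋆` and `y'⋆`, whose sum telescopes. -/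
theorem isom_toCovX (hn : 1 ≤ n) (ρ : CovariantRep (actionY n) E) :
    CovX.isom (CovY.toCovX ρ hn) = star (CovY.loop ρ) := by
  have h := congrArg₂ (· + ·) (toCovX_w_n_n hn ρ) (toCovX_w_n_succ hn ρ)
  exact h.trans (sub_add_cancel _ _)

theorem star_y_mul_y_mul_Q (ρ : CovariantRep (actionY n) E) (k : ℕ+) :
    star (CovY.loop ρ) * CovY.loop ρ * CovY.seqProj ρ k = CovY.seqProj ρ k := by
  rw [CovY.star_y_mul_y]
  unfold CovY.vertexProj CovY.seqProj
  rw [← map_mul, mul_comm, Q_mul_R, if_pos rfl]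

theorem Q_mul_y (ρ : CovariantRep (actionY n) E) (k : ℕ+) :
    CovY.seqProj ρ k * CovY.loop ρ = CovY.loop ρ * CovY.seqProj ρ (k + 1) := by
  unfold CovY.seqProj CovY.loop
  rw [← ρ.left_eq, left_Q_y]
  exact ρ.toE_op_smul _ _

/-- The start is `y⋆ R_{n+1} y = y⋆y Q_1 = Q_1` and the induction step is `y⋆ Q_k y = y⋆y Q_{k+1} =
Q_{k+1}`, as `y⋆y = R_n` dominates every `Q_k`. -/
theorem tower_star_y (ρ : CovariantRep (actionY n) E) (j : ℕ) :
    tower (star (CovY.loop ρ)) (CovY.vertexProj ρ (n + 1)) (j + 1) = CovY.seqProj ρ j.succPNat := by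
  induction j with
  | zero =>
    have h := CovY.R_mul_y ρ (n + 1)
    rw [if_pos rfl, if_neg n.succ_ne_self.symm, zero_add, CovY.toE_yPrime] at h
    rw [tower, tower, star_star, mul_assoc, h, ← mul_assoc]
    exact star_y_mul_y_mul_Q ρ 1
  | succ j ih =>
    rw [tower, ih, star_star, mul_assoc, Q_mul_y, ← mul_assoc]
    exact star_y_mul_y_mul_Q ρ _

theorem range_toCovX (hn : 1 ≤ n) (ρ : CovariantRep (actionY n) E) (j : ℕ+) :
    CovX.range (CovY.toCovX ρ hn) j = CovY.seqProj ρ j := by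
  have h := tower_star_y ρ j.natPred
  rw [PNat.succPNat_natPred, PNat.natPred_add_one] at h
  have h' : CovX.vertexProj (CovY.toCovX ρ hn) (n + 1) = CovY.vertexProj ρ (n + 1) :=
    CovY.toCovX_P ρ hn _
  rw [CovX.range, isom_toCovX, h', h]

theorem toCovY_yPrime (hn : 1 ≤ n) (ρ : CovariantRep (actionX n) D) :
    (CovX.toCovY ρ hn).toE (yPrime n) = star (CovX.edge ρ n (n + 1)) := by
  have h : CovX.isom ρ * CovX.vertexProj ρ (n + 1) = CovX.edge ρ n (n + 1) := by
    rw [CovX.isom_mul_P, if_neg n.succ_ne_self.symm, if_pos rfl, zero_add]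
  refine (CovY.toE_yPrime _).trans ?_
  refine (congrArg₂ (· * ·) (CovX.toCovY_y ρ hn) (CovX.toCovY_Q ρ hn 1)).trans ?_
  rw [← h, star_mul, CovX.star_toA_P]
  exact CovX.star_isom_mul_range ρ hn 0

theorem toCovY_ys (hn : 1 ≤ n) (ρ : CovariantRep (actionX n) D) (j : ℕ+) :
    (CovX.toCovY ρ hn).toE (ys n j) = CovX.range ρ j * star (CovX.isom ρ) := by
  refine ((CovX.toCovY ρ hn).toE_op_smul _ _).trans ?_
  rw [CovX.toCovY_y, CovX.toCovY_Q]
  exact CovX.star_isom_mul_range ρ hn j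

theorem toCovY_xn (hn : 1 ≤ n) (ρ : CovariantRep (actionX n) D) {i : ℕ} (hi : 1 ≤ i) (hin : i < n)
    (j : ℕ+) : (CovX.toCovY ρ hn).toE (xn n i j) = CovX.edge ρ i n * CovX.range ρ j := by
  refine ((CovX.toCovY ρ hn).toE_op_smul _ _).trans ?_
  rw [CovX.toCovY_x ρ hn hi hin hin.le n.le_succ, CovX.toCovY_Q]

theorem toCovX_of_lt (hn : 1 ≤ n) (ρ : CovariantRep (actionY n) E) {i j : ℕ} (hi : 1 ≤ i)
    (hin : i < n) (hij : i ≤ j) (hj : j ≤ n + 1) :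
    (CovY.toCovX ρ hn).toE (w n i j) = CovY.edge ρ i j :=
  (CovY.toCovX_w ρ hn hi hin.le hij hj).trans (CovY.imageW_of_lt ρ hin)

variable {ρX : CovariantRep (actionX n) D} {ρY : CovariantRep (actionY n) E}

theorem toCovX_roundTrip_toA (hn : 1 ≤ n) (Ψ : E →⋆ₙₐ[ℂ] D)
    (hA : ∀ b, Ψ (ρY.toA b) = (CovX.toCovY ρX hn).toA b) (c : A n) :
    Ψ ((CovY.toCovX ρY hn).toA c) = ρX.toA c := by
  refine A_hom_ext (f := Ψ.comp (CovY.toCovX ρY hn).toA) (g := ρX.toA) (fun i hi hi' => ?_) c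
  exact (congrArg Ψ (CovY.toCovX_P ρY hn i)).trans ((hA _).trans (CovX.toCovY_R ρX hn hi hi'))

theorem toCovX_roundTrip_toE (hn : 1 ≤ n) (Ψ : E →⋆ₙₐ[ℂ] D)
    (hE : ∀ ξ, Ψ (ρY.toE ξ) = (CovX.toCovY ρX hn).toE ξ)
    (hA : ∀ b, Ψ (ρY.toA b) = (CovX.toCovY ρX hn).toA b) (ξ : X n) :
    Ψ ((CovY.toCovX ρY hn).toE ξ) = ρX.toE ξ := by
  refine Representation.map_toE_of_single (l := CovY.leftX n) (projX_mul_self n)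
    (CovY.toCovX ρY hn).toRepresentation ρX.toRepresentation Ψ ?_
    (toCovX_roundTrip_toA hn Ψ hA) ξ
  rintro e
  rw [← w_eq_single]
  obtain ⟨⟨⟨i, hi⟩, ⟨j, hj⟩⟩, h1, h2⟩ := e
  rw [Finset.mem_Icc] at hi hj
  change Ψ ((CovY.toCovX ρY hn).toE (w n i j)) = ρX.toE (w n i j)
  change i ≤ n at h1
  change i ≤ j at h2
  rcases h1.lt_or_eq with h | rfl
  · exact (congrArg Ψ (toCovX_of_lt hn ρY hi.1 h h2 hj.2)).trans
      ((hE _).trans (CovX.toCovY_x ρX hn hi.1 h h2 hj.2))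
  -- Out of `v_n` there are only two edges: `w_{n,n}` returns as `s - w_{n,n+1}`, and `w_{n,n+1}` as
  -- the adjoint of the image of `y'`.
  · obtain rfl | rfl : j = i ∨ j = i + 1 := by omega
    · have hy : Ψ (CovY.loop ρY) = star (CovX.isom ρX) := (hE _).trans (CovX.toCovY_y ρX hn)
      have hy' : Ψ (CovY.loopPrime ρY) = star (CovX.edge ρX _ _) :=
        (hE _).trans (toCovY_yPrime hn ρX)
      rw [toCovX_w_n_n, map_sub, map_star, map_star, hy, hy', star_star, star_star, CovX.isom,
        add_sub_cancel_right]
      rfl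
    · have hy' : Ψ (CovY.loopPrime ρY) = star (CovX.edge ρX _ _) :=
        (hE _).trans (toCovY_yPrime hn ρX)
      rw [toCovX_w_n_succ, map_star, hy', star_star]
      rfl

/-- Naturality replaces the image under `Φ` by the composite of the two constructions applied to
`ρY`. There the `Q_j` reappear as the tower of `y⋆` over `R_{n+1}`. -/
theorem toCovY_roundTrip_toA (hn : 1 ≤ n) (Φ : D →⋆ₙₐ[ℂ] E)
    (hE : ∀ ξ, Φ (ρX.toE ξ) = (CovY.toCovX ρY hn).toE ξ)
    (hA : ∀ c, Φ (ρX.toA c) = (CovY.toCovX ρY hn).toA c) (b : B n) :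
    Φ ((CovX.toCovY ρX hn).toA b) = ρY.toA b := by
  refine (map_toCovY_toA hn ρX (CovY.toCovX ρY hn) Φ hE hA b).trans ?_
  refine B_hom_ext hn (f := (CovX.toCovY (CovY.toCovX ρY hn) hn).toA) (g := ρY.toA)
    (fun i hi hi' => ?_) (fun j => ?_) b
  · exact (CovX.toCovY_R _ hn hi hi').trans (CovY.toCovX_P ρY hn i)
  · exact (CovX.toCovY_Q _ hn j).trans (range_toCovX hn ρY j)

theorem toCovY_roundTrip_toE (hn : 1 ≤ n) (Φ : D →⋆ₙₐ[ℂ] E)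
    (hE : ∀ ξ, Φ (ρX.toE ξ) = (CovY.toCovX ρY hn).toE ξ)
    (hA : ∀ c, Φ (ρX.toA c) = (CovY.toCovX ρY hn).toA c) (ξ : Y n) :
    Φ ((CovX.toCovY ρX hn).toE ξ) = ρY.toE ξ := by
  refine Representation.map_toE_of_single (l := CovX.leftY n) (projY_mul_self n)
    (CovX.toCovY ρX hn).toRepresentation ρY.toRepresentation Φ ?_
    (toCovY_roundTrip_toA hn Φ hE hA) ξ
  intro e
  refine (congrArg Φ (CovX.toCovY_single ρX hn e)).trans ?_
  rcases e with _ | e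
  · change Φ (star (CovX.isom ρX)) = ρY.toE (y n)
    rw [map_star, map_isom ρX (CovY.toCovX ρY hn) Φ hE, isom_toCovX, star_star]
    rfl
  · rw [← x_eq_single]
    exact (hE _).trans (toCovX_of_lt hn ρY (Finset.mem_Icc.1 e.1.1.2).1 e.2.1 e.2.2
      (Finset.mem_Icc.1 e.1.2.2).2)

end RoundTrip

end QuantumDisc

end CStarCorr

namespace CStarCorr

-- The isomorphism of `𝒪_X` and `𝒪_Y`.

section InverseHomomorphisms

variable {A : Type} {E : Type} [NonUnitalCommCStarAlgebra A] [PartialOrder A]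
  [StarOrderedRing A] [NormedAddCommGroup E] [NormedSpace ℂ E] [CompleteSpace E] [SMul A E]
  [CStarModule A E]
  {B : Type} {F : Type} [NonUnitalCommCStarAlgebra B] [PartialOrder B]
  [StarOrderedRing B] [NormedAddCommGroup F] [NormedSpace ℂ F] [CompleteSpace F] [SMul B F]
  [CStarModule B F]
  {φ : LeftAction A E} {ψ : LeftAction B F}

theorem exists_equiv_of_inverse (Φ : O φ →⋆ₙₐ[ℂ] O ψ) (Ψ : O ψ →⋆ₙₐ[ℂ] O φ)
    (h : ∀ z, Ψ (Φ z) = z) (h' : ∀ z, Φ (Ψ z) = z) :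
    ∃ Θ : O φ ≃⋆ₐ[ℂ] O ψ, (∀ z, Θ z = Φ z) ∧ ∀ z, Θ.symm z = Ψ z :=
  ⟨{ Φ with
      invFun := Ψ
      left_inv := h
      right_inv := h' }, fun _ => rfl, fun _ => rfl⟩

/-- Natural constructions of covariant representations of `φ` and of `ψ` from each other which are
mutually inverse on the universal representations give an isomorphism. -/
theorem exists_equiv (G : ∀ i : AnyCovariantRep ψ, CovariantRep φ i.D) (G₀ : CovariantRep φ (O ψ))
    (hGE : ∀ i ξ, evalRep ψ i (G₀.toE ξ) = (G i).toE ξ)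
    (hGA : ∀ i a, evalRep ψ i (G₀.toA a) = (G i).toA a)
    (H : ∀ i : AnyCovariantRep φ, CovariantRep ψ i.D) (H₀ : CovariantRep ψ (O φ))
    (hHE : ∀ i ξ, evalRep φ i (H₀.toE ξ) = (H i).toE ξ)
    (hHA : ∀ i a, evalRep φ i (H₀.toA a) = (H i).toA a)
    (hGH : ∀ Ψ : O ψ →⋆ₙₐ[ℂ] O φ, (∀ ξ, Ψ ((universalRep ψ).toE ξ) = H₀.toE ξ) →
      (∀ b, Ψ ((universalRep ψ).toA b) = H₀.toA b) →
      (∀ ξ, Ψ (G₀.toE ξ) = (universalRep φ).toE ξ) ∧ ∀ a, Ψ (G₀.toA a) = (universalRep φ).toA a)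
    (hHG : ∀ Φ : O φ →⋆ₙₐ[ℂ] O ψ, (∀ ξ, Φ ((universalRep φ).toE ξ) = G₀.toE ξ) →
      (∀ a, Φ ((universalRep φ).toA a) = G₀.toA a) →
      (∀ ξ, Φ (H₀.toE ξ) = (universalRep ψ).toE ξ) ∧ ∀ b, Φ (H₀.toA b) = (universalRep ψ).toA b) :
    ∃ Θ : O φ ≃⋆ₐ[ℂ] O ψ,
      ((∀ ξ, Θ ((universalRep φ).toE ξ) = G₀.toE ξ) ∧
        ∀ a, Θ ((universalRep φ).toA a) = G₀.toA a) ∧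
      (∀ ξ, Θ.symm ((universalRep ψ).toE ξ) = H₀.toE ξ) ∧
        ∀ b, Θ.symm ((universalRep ψ).toA b) = H₀.toA b := by
  obtain ⟨Φ, hΦE, hΦA⟩ := exists_hom G G₀ hGE hGA
  obtain ⟨Ψ, hΨE, hΨA⟩ := exists_hom H H₀ hHE hHA
  obtain ⟨h1, h2⟩ := hGH Ψ hΨE hΨA
  obtain ⟨h3, h4⟩ := hHG Φ hΦE hΦA
  obtain ⟨Θ, hΘ, hΘ'⟩ := exists_equiv_of_inverse Φ Ψ
    (O_hom_eq_self (Ψ.comp Φ) (fun ξ => (congrArg Ψ (hΦE ξ)).trans (h1 ξ))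
      fun a => (congrArg Ψ (hΦA a)).trans (h2 a))
    (O_hom_eq_self (Φ.comp Ψ) (fun ξ => (congrArg Φ (hΨE ξ)).trans (h3 ξ))
      fun a => (congrArg Φ (hΨA a)).trans (h4 a))
  exact ⟨Θ, ⟨fun ξ => (hΘ _).trans (hΦE ξ), fun a => (hΘ _).trans (hΦA a)⟩,
    fun ξ => (hΘ' _).trans (hΨE ξ), fun a => (hΘ' _).trans (hΨA a)⟩

end InverseHomomorphisms

namespace QuantumDisc

variable {n : ℕ}

theorem a_eq_range (j : ℕ) : a n j = CovX.range (universalRep (actionX n)) j := by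
  induction j with
  | zero => rfl
  | succ j ih => exact congrArg (fun z => s n * z * star (s n)) ih

/-- Naturality along the evaluations `evalRep` supplies the compatibility of the families with the
representations on `OX n` and `OY n`; the round trips supply the inverse property. -/
theorem exists_equiv_OX_OY (hn : 1 ≤ n) : ∃ Θ : OX n ≃⋆ₐ[ℂ] OY n,
    ((∀ ξ, Θ (piX n ξ) = (CovY.toCovX (universalRep (actionY n)) hn).toE ξ) ∧
      ∀ c, Θ (piA n c) = (CovY.toCovX (universalRep (actionY n)) hn).toA c) ∧
    (∀ ξ, Θ.symm (piY n ξ) = (CovX.toCovY (universalRep (actionX n)) hn).toE ξ) ∧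
      ∀ b, Θ.symm (piB n b) = (CovX.toCovY (universalRep (actionX n)) hn).toA b :=
  exists_equiv (φ := actionX n) (ψ := actionY n)
    (fun i => CovY.toCovX i.rep hn) (CovY.toCovX (universalRep (actionY n)) hn)
    (fun i => map_toCovX_toE hn _ i.rep (evalRep (actionY n) i) (evalRep_toE i) (evalRep_toA i))
    (fun i => map_toCovX_toA hn _ i.rep (evalRep (actionY n) i) (evalRep_toA i))
    (fun i => CovX.toCovY i.rep hn) (CovX.toCovY (universalRep (actionX n)) hn)
    (fun i => map_toCovY_toE hn _ i.rep (evalRep (actionX n) i) (evalRep_toE i) (evalRep_toA i))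
    (fun i => map_toCovY_toA hn _ i.rep (evalRep (actionX n) i) (evalRep_toE i) (evalRep_toA i))
    (fun Ψ hE hA => ⟨toCovX_roundTrip_toE hn Ψ hE hA, toCovX_roundTrip_toA hn Ψ hA⟩)
    (fun Φ hE hA => ⟨toCovY_roundTrip_toE hn Φ hE hA, toCovY_roundTrip_toA hn Φ hE hA⟩)

end QuantumDisc

end CStarCorr

end

set_option maxHeartbeats 2000000 in
open CStarCorr CStarCorr.QuantumDisc in
theorem mainTheorem5 (n : ℕ) (hn : 1 ≤ n) :
    ∃ Φ : OX n ≃⋆ₐ[ℂ] OY n,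
      -- the isomorphism on the generators of `𝒪_X`
      (∀ i, 1 ≤ i → i ≤ n + 1 → Φ (piA n (P n i)) = piB n (R n i)) ∧
      (∀ i j, 1 ≤ i → i < n → i ≤ j → j ≤ n + 1 → Φ (piX n (w n i j)) = piY n (x n i j)) ∧
      Φ (piX n (w n n n)) = star (piY n (y n)) - star (piY n (yPrime n)) ∧
      Φ (piX n (w n n (n + 1))) = star (piY n (yPrime n)) ∧
      -- its inverse on the generators of `𝒪_Y`
      (∀ i, 1 ≤ i → i ≤ n + 1 → Φ.symm (piB n (R n i)) = piA n (P n i)) ∧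
      (∀ j : ℕ+, Φ.symm (piB n (Q n j)) = a n j) ∧
      (∀ i j, 1 ≤ i → i < n → i ≤ j → j ≤ n + 1 → Φ.symm (piY n (x n i j)) = piX n (w n i j)) ∧
      (∀ i, ∀ j : ℕ+, 1 ≤ i → i < n → Φ.symm (piY n (xn n i j)) = piX n (w n i n) * a n j) ∧
      Φ.symm (piY n (y n)) = star (s n) ∧
      Φ.symm (piY n (yPrime n)) = star (piX n (w n n (n + 1))) ∧
      (∀ j : ℕ+, Φ.symm (piY n (ys n j)) = a n j * star (s n)) := by
  refine (exists_equiv_OX_OY hn).elim fun Θ h => ?_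
  have hX := h.1.1
  have hA := h.1.2
  have hY := h.2.1
  have hB := h.2.2
  clear h
  refine Exists.intro Θ ⟨fun i _ _ => ?_, fun i j hi hin hij hj => ?_, ?_, ?_, fun i hi hi' => ?_,
    fun j => ?_, fun i j hi hin hij hj => ?_, fun i j hi hin => ?_, ?_, ?_, fun j => ?_⟩
  · exact (hA _).trans (CovY.toCovX_P _ hn i)
  · exact (hX _).trans (toCovX_of_lt hn _ hi hin hij hj)
  · exact (hX _).trans (toCovX_w_n_n hn _)
  · exact (hX _).trans (toCovX_w_n_succ hn _)
  · exact (hB _).trans (CovX.toCovY_R _ hn hi hi')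
  · exact (hB _).trans ((CovX.toCovY_Q _ hn j).trans (a_eq_range j).symm)
  · exact (hY _).trans (CovX.toCovY_x _ hn hi hin hij hj)
  · refine (hY _).trans ((toCovY_xn hn _ hi hin j).trans ?_)
    exact congrArg (fun z => piX n (w n i n) * z) (a_eq_range j).symm
  · exact (hY _).trans (CovX.toCovY_y _ hn)
  · exact (hY _).trans (toCovY_yPrime hn _)
  · refine (hY _).trans ((toCovY_ys hn _ j).trans ?_)
    exact congrArg (fun z => z * star (s n)) (a_eq_range j).symm
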